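/- **Corollary 2 (94.2% of compound capacity).** A binary memoryless channel (BMC) is a $2\times 2$ stochastic matrix $W(y|x)$, $x,y\in\{0,1\}$, used memorylessly: $W^n(y|x)=\prod_{i=1}^n W(y(i)|x(i))$. A code of block length $n\ge 1$ with $M\ge 1$ messages consists of codewords $x_1,\dots,x_M\in\{0,1\}^n$ and a decoder $G:\{0,1\}^n\to\{1,\dots,M\}$; its rate is $\frac1n\log_2 M$ and its average error probability on $W$ is $P_e(W)=\frac1M\sum_{m}\sum_{y:\,G(y)\neq m}W^n(y|x_m)$. For a nonempty set $\mathcal S$ of BMCs, a rate $R$ is achievable on $\mathcal S$ if for every $\epsilon>0$ there is a code of some block length $n\ge 1$ and rate at least $R$ with $P_e(W)<\epsilon$ for all $W\in\mathcal S$; the compound capacity $C(\mathcal S)$ is the supremum of the achievable rates. For single-letter metrics $d_1,d_2:\{0,1\}^2\to\mathbb R$, a generalized linear decoder induced by $d_1,d_2$ is a decoder that outputs, for every $y$, a message $m$ maximizing $\max_{k=1,2}\sum_{i=1}^n d_k(x_m(i),y(i))$, ties being resolved arbitrarily. A rate $R$ is achievable on $\mathcal S$ with the decoder induced by $d_1,d_2$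 if for every $\epsilon>0$ there are $n\ge 1$ and a codebook of block length $n$ and rate at least $R$ such that every generalized linear decoder induced by $d_1,d_2$ for this codebook has $P_e(W)<\epsilon$ for all $W\in\mathcal S$. There exist two metrics $d_1,d_2:\{0,1\}^2\to\mathbb R$ such that for every nonempty set $\mathcal S$ of BMCs: 1. the rate $0.942\cdot C(\mathcal S)$ is achievable on $\mathcal S$ with the generalized linear decoder induced by $d_1,d_2$; 2. if the uniform distribution on $\{0,1\}$ maximizes $P\mapsto\inf_{W\in\mathcal S}I(P,W)$ over all probability distributions $P$ on $\{0,1\}$, where $I(P,W)$ is the mutual information between the input and the output of $W$ under the input distribution $P$, then the supremum of the rates achievable on $\mathcal S$ with the generalized linear decoder induced by $d_1,d_2$ equals $C(\mathcal S)$. -/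

import Mathlib

namespace CompoundChannel

/-- A discrete memoryless channel: a stochastic matrix `W x y = W(y|x)`. -/
@[ext]
structure DMC (X Y : Type) [Fintype Y] where
  W : X → Y → ℝ
  nonneg : ∀ x y, 0 ≤ W x y
  sum_eq_one : ∀ x, ∑ y, W x y = 1

/-- A binary memoryless channel: binary input and binary output. -/
abbrev BMC : Type := DMC Bool Bool

/-- The mutual information `I(P, W)` in bits, as the divergence of the joint law `P ∘ W`
from the product of its marginals (a term with `P x * W x y = 0` contributes `0`). -/
noncomputable def mutualInfo {X Y : Type} [Fintype X] [Fintype Y]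
    (P : X → ℝ) (W : DMC X Y) : ℝ :=
  ∑ x, ∑ y, P x * W.W x y *
    Real.logb 2 (P x * W.W x y / (P x * ∑ x', P x' * W.W x' y))

/-- The worst-case mutual information `inf_{W ∈ S} I(P, W)` of the input law `P` over `S`. -/
noncomputable def worstInfo {X Y : Type} [Fintype X] [Fintype Y]
    (S : Set (DMC X Y)) (P : X → ℝ) : ℝ :=
  ⨅ W : S, mutualInfo P W.1

/-- `P` is an optimal input law for `S`: it maximizes `inf_{W ∈ S} I(P, W)` over all laws. -/
def IsOptimalInput {X Y : Type} [Fintype X] [Fintype Y]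
    (S : Set (DMC X Y)) (P : X → ℝ) : Prop :=
  P ∈ stdSimplex ℝ X ∧ IsMaxOn (worstInfo S) (stdSimplex ℝ X) P

/-- The uniform law on the binary alphabet. -/
noncomputable def uniformInput : Bool → ℝ := fun _ => 1 / 2

/-- The memoryless extension `Wⁿ(y|x) = ∏ W(y(i)|x(i))`. -/
def DMC.blockProb {X Y : Type} [Fintype Y] (W : DMC X Y) {n : ℕ}
    (x : Fin n → X) (y : Fin n → Y) : ℝ :=
  ∏ i, W.W (x i) (y i)

/-- The average probability of error of the code with codewords `F m` and decoder `G`. -/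
noncomputable def errorProb {X Y : Type} [Fintype Y] {n M : ℕ}
    (F : Fin M → Fin n → X) (G : (Fin n → Y) → Fin M) (W : DMC X Y) : ℝ :=
  (1 / (M : ℝ)) * ∑ m, ∑ y, if G y = m then 0 else W.blockProb (F m) y

/-- The rate `R` (in bits per channel use) is achievable on the compound set `S`. -/
def Achievable {X Y : Type} [Fintype Y] (S : Set (DMC X Y)) (R : ℝ) : Prop :=
  ∀ ε : ℝ, 0 < ε → ∃ n M : ℕ, 0 < n ∧ (2 : ℝ) ^ ((n : ℝ) * R) ≤ (M : ℝ) ∧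
    ∃ (F : Fin M → Fin n → X) (G : (Fin n → Y) → Fin M), ∀ W ∈ S, errorProb F G W < ε

/-- The compound capacity: the supremum of all rates achievable on `S`. -/
noncomputable def compoundCapacity {X Y : Type} [Fintype Y] (S : Set (DMC X Y)) : ℝ :=
  sSup {R : ℝ | Achievable S R}

/-- The score `max_k ∑ i, d k (x i) (y i)` induced by finitely many single-letter metrics. -/
noncomputable def score {X Y : Type} {K n : ℕ} (d : Fin K → X → Y → ℝ)
    (x : Fin n → X) (y : Fin n → Y) : ℝ :=
  ⨆ k, ∑ i, d k (x i) (y i)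

/-- `G` is a generalized linear decoder induced by the metrics `d` for the codebook `F`:
it outputs a message of maximal score, with an arbitrary resolution of ties. -/
def IsGLD {X Y : Type} {K n M : ℕ} (d : Fin K → X → Y → ℝ)
    (F : Fin M → Fin n → X) (G : (Fin n → Y) → Fin M) : Prop :=
  ∀ y m, score d (F m) y ≤ score d (F (G y)) y

/-- The rate `R` is achievable on `S` with the generalized linear decoder induced by `d`,
however ties are resolved. (As `M ≥ 1` is forced, such a decoder always exists.) -/
def AchievableByGLD {X Y : Type} [Fintype Y] {K : ℕ} (d : Fin K → X → Y → ℝ)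
    (S : Set (DMC X Y)) (R : ℝ) : Prop :=
  ∀ ε : ℝ, 0 < ε → ∃ n M : ℕ, 0 < n ∧ (2 : ℝ) ^ ((n : ℝ) * R) ≤ (M : ℝ) ∧
    ∃ F : Fin M → Fin n → X, ∀ G : (Fin n → Y) → Fin M, IsGLD d F G →
      ∀ W ∈ S, errorProb F G W < ε

end CompoundChannel

/-! ### Power series and the two-point Jensen gap of `x log x`. -/

namespace CompoundChannel

open Filter Topology

/-! The two metrics count agreements and disagreements of letters. Let `I₀` be the worst-case
information of the uniform input. Three facts give the theorem: every rate below `I₀` is achieved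
with these metrics; every achievable rate is, up to `η`, at most the worst-case information of some
input law; and the uniform law keeps the fraction `e log 2 / 2 ≈ 0.94208` of the information of any
law, on every binary channel. If the uniform law is optimal, the first two facts already meet at the
capacity.

Direct part (`exists_balanced_codebook`, `achievableByGLD_of_lt`): codewords are drawn among words
with as many ones as zeros. For such words and a fixed output, the joint type has one free
parameter, so the likelihood is monotone in the agreement, increasing or decreasing according to the
channel. A competitor that beats the sent word in the maximum of the two scores is therefore at
least as likely as the sent word, itself or after complementation. This costs a factor two in the
union bound. Weights that dominate all memoryless channels at polynomial cost let one codebook serve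
the whole set.

Converse (`fano_codebookLaw`): a Fano inequality for the empirical letter law of the codebook, which
does not depend on the channel.

Comparison (`jensenGap_le`): mutual information is a sum over outputs of Jensen gaps of `x log x`.
By homogeneity the two values may be taken as `1 - δ` and `1 + δ`. A power series comparison moves
the worst ratio to `δ = 1`, where the gap is `-2p log p ≤ 2 / e`, against `log 2` for the uniform
weight. -/

lemma hasSum_of_eq {f g : ℕ → ℝ} {a b : ℝ} (h : HasSum f a) (hfg : ∀ n, g n = f n)
    (hab : b = a) : HasSum g b := by
  rwa [hab, show g = f from funext hfg]

/-- The convex function `(1 - x) log (1 - x) + x`. -/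
noncomputable def entropySeries (x : ℝ) : ℝ := (1 - x) * Real.log (1 - x) + x

lemma continuous_entropySeries : Continuous entropySeries := by
  unfold entropySeries
  exact (Real.continuous_mul_log.comp (continuous_const.sub continuous_id)).add continuous_id

/-- Subtracting the tail of the series of `-log (1 - x)` from `x` times that series leaves the
coefficients `1 / (n + 1) - 1 / (n + 2)`. -/
lemma hasSum_entropySeries {x : ℝ} (hx : |x| < 1) :
    HasSum (fun n : ℕ => x ^ (n + 2) / ((n + 1) * (n + 2))) (entropySeries x) := by
  have h := Real.hasSum_pow_div_log_of_abs_lt_one hx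
  have h1 := h.mul_left x
  have h2 : HasSum (fun n : ℕ => x ^ (n + 1 + 1) / ((n + 1 : ℕ) + 1 : ℝ))
      (-Real.log (1 - x) - x) := by
    have := (hasSum_nat_add_iff' 1).2 h
    simpa using this
  have h3 := h1.sub h2
  refine hasSum_of_eq h3 (fun n => ?_) ?_
  · push_cast
    have : (n : ℝ) + 1 ≠ 0 := by positivity
    have : (n : ℝ) + 2 ≠ 0 := by positivity
    have : (n : ℝ) + 1 + 1 ≠ 0 := by positivity
    field_simp
    ring
  · unfold entropySeries; ring

/-- The even part of `entropySeries`. -/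
noncomputable def evenPart (x : ℝ) : ℝ := (entropySeries x + entropySeries (-x)) / 2

/-- The odd part of `entropySeries`. -/
noncomputable def oddPart (x : ℝ) : ℝ := (entropySeries x - entropySeries (-x)) / 2

lemma entropySeries_eq (x : ℝ) : entropySeries x = evenPart x + oddPart x := by
  unfold evenPart oddPart; ring

lemma continuous_evenPart : Continuous evenPart :=
  (continuous_entropySeries.add (continuous_entropySeries.comp continuous_neg)).div_const 2

lemma continuous_oddPart : Continuous oddPart :=
  (continuous_entropySeries.sub (continuous_entropySeries.comp continuous_neg)).div_const 2

lemma hasSum_evenPart {x : ℝ} (hx : |x| < 1) :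
    HasSum (fun j : ℕ => x ^ (2 * j + 2) / ((2 * j + 1) * (2 * j + 2))) (evenPart x) := by
  have h := ((hasSum_entropySeries hx).add
    (hasSum_entropySeries (x := -x) (by simpa using hx))).div_const 2
  have hinj : Function.Injective (fun j : ℕ => 2 * j) := fun a b hab => by simpa using hab
  have h' := (hinj.hasSum_iff (f := fun n : ℕ => (x ^ (n + 2) / (((n : ℝ) + 1) * (n + 2)) +
    (-x) ^ (n + 2) / ((n + 1) * (n + 2))) / 2) ?_).2 h
  · refine hasSum_of_eq h' (fun j => ?_) rfl
    have : Even (2 * j + 2) := ⟨j + 1, by ring⟩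
    simp only [Function.comp, this.neg_pow]
    push_cast; ring
  · intro n hn
    have hodd : Odd (n + 2) := by
      rw [← Nat.not_even_iff_odd]
      rintro ⟨k, hk⟩
      exact hn ⟨k - 1, by simp only; omega⟩
    rw [hodd.neg_pow]; ring

lemma hasSum_oddPart {x : ℝ} (hx : |x| < 1) :
    HasSum (fun j : ℕ => x ^ (2 * j + 3) / ((2 * j + 2) * (2 * j + 3))) (oddPart x) := by
  have h := ((hasSum_entropySeries hx).sub
    (hasSum_entropySeries (x := -x) (by simpa using hx))).div_const 2
  have hinj : Function.Injective (fun j : ℕ => 2 * j + 1) := fun a b hab => by simpa using hab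
  have h' := (hinj.hasSum_iff (f := fun n : ℕ => (x ^ (n + 2) / (((n : ℝ) + 1) * (n + 2)) -
    (-x) ^ (n + 2) / ((n + 1) * (n + 2))) / 2) ?_).2 h
  · refine hasSum_of_eq h' (fun j => ?_) rfl
    have : Odd (2 * j + 1 + 2) := ⟨j + 1, by ring⟩
    simp only [Function.comp, this.neg_pow]
    push_cast; ring
  · intro n hn
    have heven : Even (n + 2) := by
      rw [← Nat.not_odd_iff_even]
      rintro ⟨k, hk⟩
      exact hn ⟨k - 1, by simp only; omega⟩
    rw [heven.neg_pow]; ring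

/-- A ratio of power series is increasing when the ratio of the coefficients is. -/
lemma hasSum_le_mul_of_monotone {b ρ : ℕ → ℝ} (hb : ∀ j, 0 ≤ b j) (hρ : Monotone ρ)
    {x x' K S T S' T' : ℝ} (hx : 0 < x) (hxx : x ≤ x')
    (hS : HasSum (fun j => b j * ρ j * x ^ j) S) (hT : HasSum (fun j => b j * x ^ j) T)
    (hS' : HasSum (fun j => b j * ρ j * x' ^ j) S') (hT' : HasSum (fun j => b j * x' ^ j) T')
    (h : S' ≤ K * T') : S ≤ K * T := by
  have hD := hS.sub (hT.mul_left K)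
  have hD' := hS'.sub (hT'.mul_left K)
  have hx' : 0 < x' := hx.trans_le hxx
  by_cases hK : ∃ k, K ≤ ρ k
  · classical
    -- The coefficients `ρ j - K` change sign once, at `k`. Replacing `(x / x') ^ j` by `(x / x') ^
    -- k` can then only increase each term, whichever side of `k` it lies on.
    set k := Nat.find hK with hk
    have hkK : K ≤ ρ k := Nat.find_spec hK
    have hr0 : 0 < x / x' := div_pos hx hx'
    have hr1 : x / x' ≤ 1 := (div_le_one hx').2 hxx
    have hle : S - K * T ≤ (x / x') ^ k * (S' - K * T') := by
      refine hasSum_le (fun j => ?_) hD (hD'.mul_left _)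
      have hxj : x ^ j = (x / x') ^ j * x' ^ j := by
        rw [← mul_pow, div_mul_cancel₀ _ hx'.ne']
      have e1 : b j * ρ j * x ^ j - K * (b j * x ^ j)
          = b j * x' ^ j * ((ρ j - K) * (x / x') ^ j) := by rw [hxj]; ring
      have e2 : (x / x') ^ k * (b j * ρ j * x' ^ j - K * (b j * x' ^ j))
          = b j * x' ^ j * ((ρ j - K) * (x / x') ^ k) := by ring
      rw [e1, e2]
      refine mul_le_mul_of_nonneg_left ?_ (mul_nonneg (hb j) (by positivity))
      rcases lt_or_ge j k with hj | hj
      · have : ρ j < K := not_le.1 (Nat.find_min hK hj)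
        exact mul_le_mul_of_nonpos_left (pow_le_pow_of_le_one hr0.le hr1 hj.le) (by linarith)
      · have : K ≤ ρ j := hkK.trans (hρ hj)
        exact mul_le_mul_of_nonneg_left (pow_le_pow_of_le_one hr0.le hr1 hj) (by linarith)
    have : (x / x') ^ k * (S' - K * T') ≤ 0 :=
      mul_nonpos_of_nonneg_of_nonpos (by positivity) (by linarith)
    linarith
  · push Not at hK
    have : S - K * T ≤ 0 := by
      refine hasSum_le (fun j => ?_) hD hasSum_zero
      have : 0 ≤ b j * x ^ j := mul_nonneg (hb j) (by positivity)
      nlinarith [hK j]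
    linarith

/-- `-x log x ≤ 1 / e`. -/
lemma negMulLog_le_inv_exp {x : ℝ} (hx : 0 ≤ x) : -(x * Real.log x) ≤ (Real.exp 1)⁻¹ := by
  rcases hx.eq_or_lt with rfl | hx
  · simp; positivity
  have h := Real.log_le_sub_one_of_pos (x := (x * Real.exp 1)⁻¹) (by positivity)
  rw [Real.log_inv, Real.log_mul hx.ne' (Real.exp_pos _).ne', Real.log_exp, mul_inv] at h
  have h2 : -Real.log x ≤ x⁻¹ * (Real.exp 1)⁻¹ := by linarith
  calc -(x * Real.log x) = x * (-Real.log x) := by ring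
    _ ≤ x * (x⁻¹ * (Real.exp 1)⁻¹) := mul_le_mul_of_nonneg_left h2 hx.le
    _ = (Real.exp 1)⁻¹ := by field_simp

/-- The coefficient ratio of the two series that are compared. -/
noncomputable def coeffRatio (σ : ℝ) (j : ℕ) : ℝ :=
  (1 - σ ^ (2 * j + 2)) * (1 + σ * ((2 * j + 1) / (2 * j + 3)))

lemma monotone_coeffRatio {σ : ℝ} (h0 : 0 ≤ σ) (h1 : σ ≤ 1) : Monotone (coeffRatio σ) := by
  refine monotone_nat_of_le_succ fun j => ?_
  unfold coeffRatio
  have e1 : σ ^ (2 * (j + 1) + 2) ≤ σ ^ (2 * j + 2) := pow_le_pow_of_le_one h0 h1 (by omega)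
  have e2 : σ ^ (2 * (j + 1) + 2) ≤ 1 := pow_le_one₀ h0 h1
  have e3 : ((2 * j + 1 : ℝ) / (2 * j + 3)) ≤
      (2 * ((j + 1 : ℕ) : ℝ) + 1) / (2 * ((j + 1 : ℕ) : ℝ) + 3) := by
    push_cast
    rw [div_le_div_iff₀ (by positivity) (by positivity)]
    nlinarith
  have e4 : 0 ≤ ((2 * j + 1 : ℝ) / (2 * j + 3)) := by positivity
  apply mul_le_mul
  · linarith
  · have := mul_le_mul_of_nonneg_left e3 h0
    linarith
  · have := mul_nonneg h0 e4
    linarith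
  · linarith

/-- Dividing the odd contribution by `x` aligns its powers with the even ones, so the sum is a
series in `x ^ 2` whose coefficients are those of `evenPart` times an increasing factor. -/
lemma hasSum_coeffRatio {x σ : ℝ} (hx0 : 0 < x) (hx1 : x < 1) (h0 : 0 ≤ σ) (h1 : σ ≤ 1) :
    HasSum (fun j : ℕ => (x ^ 2 / ((2 * j + 1) * (2 * j + 2))) * coeffRatio σ j * (x ^ 2) ^ j)
      (evenPart x - evenPart (σ * x) + (σ * oddPart x - oddPart (σ * x)) / x) := by
  have hx : |x| < 1 := by rwa [abs_of_pos hx0]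
  have hsx : |σ * x| < 1 := by
    rw [abs_of_nonneg (by positivity)]
    nlinarith
  have h := ((hasSum_evenPart hx).sub (hasSum_evenPart hsx)).add
    ((((hasSum_oddPart hx).mul_left σ).sub (hasSum_oddPart hsx)).div_const x)
  refine hasSum_of_eq h (fun j => ?_) rfl
  unfold coeffRatio
  have a1 : (2 * j + 1 : ℝ) ≠ 0 := by positivity
  have a2 : (2 * j + 2 : ℝ) ≠ 0 := by positivity
  have a3 : (2 * j + 3 : ℝ) ≠ 0 := by positivity
  have : x ≠ 0 := hx0.ne'
  rw [← pow_mul]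
  field_simp
  ring

/-- The comparison of the two-point Jensen gaps at weight `(1 - σ) / 2` and at weight `1 / 2`. -/
lemma evenPart_add_le {δ σ K : ℝ} (hδ0 : 0 < δ) (hδ1 : δ ≤ 1) (h0 : 0 ≤ σ) (h1 : σ ≤ 1)
    (hK : 2 * (Real.exp 1)⁻¹ < K * Real.log 2) :
    evenPart δ + σ * oddPart δ - entropySeries (σ * δ) ≤ K * evenPart δ := by
  have eA : evenPart 1 = Real.log 2 := by
    unfold evenPart entropySeries; norm_num
  have eO : oddPart 1 = 1 - Real.log 2 := by
    unfold oddPart entropySeries; norm_num; ring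
  -- At the endpoint the left side is `-2p log p` with `p = (1 - σ) / 2`, hence at most `2 / e`.
  have hone : evenPart 1 + σ * oddPart 1 - entropySeries σ < K * evenPart 1 := by
    rw [eA, eO]
    refine lt_of_le_of_lt ?_ hK
    have h := negMulLog_le_inv_exp (x := (1 - σ) / 2) (by linarith)
    rcases h1.eq_or_lt with rfl | h1
    · simp [entropySeries]; positivity
    · rw [Real.log_div (by linarith) (by norm_num)] at h
      unfold entropySeries
      linarith
  rcases hδ1.eq_or_lt with rfl | hδ1
  · simpa using hone.le
  set D : ℝ → ℝ := fun x =>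
    evenPart x - evenPart (σ * x) + (σ * oddPart x - oddPart (σ * x)) / x - K * evenPart x with hD
  have hcont : ContinuousAt D 1 := by
    have h3 := continuous_evenPart
    have h4 := continuous_oddPart
    have hn : ContinuousAt (fun x => σ * oddPart x - oddPart (σ * x)) 1 := by
      apply Continuous.continuousAt; fun_prop
    have hq := hn.div continuousAt_id (one_ne_zero)
    have hm : ContinuousAt (fun x => evenPart x - evenPart (σ * x)) 1 := by
      apply Continuous.continuousAt; fun_prop
    exact (hm.add hq).sub (continuousAt_const.mul h3.continuousAt)
  have hD1 : D 1 < 0 := by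
    simp only [hD, mul_one, div_one]
    rw [entropySeries_eq] at hone
    linarith
  -- The series are available only inside the unit interval. The strict endpoint inequality survives
  -- at some `x` between `δ` and `1`, and the comparison runs from there down to `δ`.
  have hev : ∀ᶠ x in 𝓝[<] (1 : ℝ), D x < 0 ∧ x ∈ Set.Ioo δ 1 :=
    ((hcont.eventually_lt_const hD1).filter_mono nhdsWithin_le_nhds).and
      (Ioo_mem_nhdsLT hδ1)
  obtain ⟨x, hxD, hx⟩ := hev.exists
  have hx0 : 0 < x := hδ0.trans hx.1
  have key := hasSum_le_mul_of_monotone (b := fun j : ℕ => 1 / ((2 * j + 1) * (2 * j + 2)))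
    (ρ := coeffRatio σ) (x := δ ^ 2) (x' := x ^ 2) (K := K)
    (S := (evenPart δ - evenPart (σ * δ) + (σ * oddPart δ - oddPart (σ * δ)) / δ) / δ ^ 2)
    (T := evenPart δ / δ ^ 2)
    (S' := (evenPart x - evenPart (σ * x) + (σ * oddPart x - oddPart (σ * x)) / x) / x ^ 2)
    (T' := evenPart x / x ^ 2)
    (fun j => by positivity) (monotone_coeffRatio h0 h1) (by positivity)
    (pow_le_pow_left₀ hδ0.le hx.1.le 2) ?_ ?_ ?_ ?_ ?_
  -- The gap contains the odd contribution undivided. It is nonnegative and `δ ≤ 1`, so the divided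
  -- version dominates it.
  · have hodd : 0 ≤ σ * oddPart δ - oddPart (σ * δ) := by
      have hd : |δ| < 1 := by rwa [abs_of_pos hδ0]
      have hsd : |σ * δ| < 1 := by
        rw [abs_of_nonneg (by positivity)]
        nlinarith
      have := ((hasSum_oddPart hd).mul_left σ).sub (hasSum_oddPart hsd)
      refine this.nonneg fun j => ?_
      have e : σ * (δ ^ (2 * j + 3) / ((2 * j + 2) * (2 * j + 3))) -
          (σ * δ) ^ (2 * j + 3) / ((2 * j + 2) * (2 * j + 3)) =
          (δ ^ (2 * j + 3) / ((2 * j + 2) * (2 * j + 3))) * (σ * (1 - σ ^ (2 * j + 2))) := by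
        rw [mul_pow]; ring
      rw [e]
      have : σ ^ (2 * j + 2) ≤ 1 := pow_le_one₀ h0 h1
      exact mul_nonneg (by positivity) (mul_nonneg h0 (by linarith))
    have h2 : σ * oddPart δ - oddPart (σ * δ) ≤ (σ * oddPart δ - oddPart (σ * δ)) / δ :=
      le_div_self hodd hδ0 hδ1.le
    rw [← mul_div_assoc, div_le_div_iff_of_pos_right (by positivity)] at key
    rw [entropySeries_eq]
    linarith
  · refine hasSum_of_eq ((hasSum_coeffRatio hδ0 hδ1 h0 h1).div_const (δ ^ 2))
      (fun j => ?_) rfl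
    have : δ ≠ 0 := hδ0.ne'
    field_simp
  · refine hasSum_of_eq ((hasSum_evenPart (x := δ) (by rwa [abs_of_pos hδ0])).div_const (δ ^ 2))
      (fun j => ?_) rfl
    have : δ ≠ 0 := hδ0.ne'
    rw [← pow_mul]
    field_simp
    ring
  · refine hasSum_of_eq ((hasSum_coeffRatio hx0 hx.2 h0 h1).div_const (x ^ 2))
      (fun j => ?_) rfl
    have : x ≠ 0 := hx0.ne'
    field_simp
  · refine hasSum_of_eq ((hasSum_evenPart (x := x) (by rw [abs_of_pos hx0]; exact hx.2)).div_const
      (x ^ 2)) (fun j => ?_) rfl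
    have : x ≠ 0 := hx0.ne'
    rw [← pow_mul]
    field_simp
    ring
  · rw [← mul_div_assoc, div_le_div_iff_of_pos_right (by positivity)]
    simp only [hD] at hxD
    linarith

/-- The Jensen gap of `x log x` at `u`, `v` with weights `1 - p`, `p`. -/
noncomputable def jensenGap (u v p : ℝ) : ℝ :=
  (1 - p) * (u * Real.log u) + p * (v * Real.log v) -
    ((1 - p) * u + p * v) * Real.log ((1 - p) * u + p * v)

lemma jensenGap_symm (u v p : ℝ) : jensenGap v u (1 - p) = jensenGap u v p := by
  unfold jensenGap
  rw [show (1 - (1 - p)) * v + (1 - p) * u = (1 - p) * u + p * v by ring]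
  ring

lemma mul_mul_log_mul {a : ℝ} (ha : a ≠ 0) (x : ℝ) :
    a * x * Real.log (a * x) = a * (x * Real.log x) + x * (a * Real.log a) := by
  rcases eq_or_ne x 0 with rfl | hx
  · simp
  · rw [Real.log_mul ha hx]; ring

/-- Scaling adds to `x log x` a term linear in `x`, whose Jensen gap vanishes. -/
lemma jensenGap_mul {a : ℝ} (ha : a ≠ 0) (u v p : ℝ) :
    jensenGap (a * u) (a * v) p = a * jensenGap u v p := by
  unfold jensenGap
  rw [show (1 - p) * (a * u) + p * (a * v) = a * ((1 - p) * u + p * v) by ring,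
    mul_mul_log_mul ha, mul_mul_log_mul ha, mul_mul_log_mul ha]
  ring

lemma jensenGap_nonneg {u v p : ℝ} (hu : 0 ≤ u) (hv : 0 ≤ v) (h0 : 0 ≤ p) (h1 : p ≤ 1) :
    0 ≤ jensenGap u v p := by
  have := Real.convexOn_mul_log.2 (Set.mem_Ici.2 hu) (Set.mem_Ici.2 hv)
    (show 0 ≤ 1 - p by linarith) h0 (by ring)
  simp only [smul_eq_mul] at this
  unfold jensenGap
  linarith

/-- `entropySeries` differs from `(1 - x) log (1 - x)` by a linear term, which has no Jensen gap. -/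
lemma jensenGap_eq (δ σ : ℝ) :
    jensenGap (1 - δ) (1 + δ) ((1 - σ) / 2) =
      evenPart δ + σ * oddPart δ - entropySeries (σ * δ) := by
  unfold jensenGap evenPart oddPart entropySeries
  rw [show (1 - (1 - σ) / 2) * (1 - δ) + (1 - σ) / 2 * (1 + δ) = 1 - σ * δ by ring, sub_neg_eq_add]
  ring

lemma jensenGap_half_eq (δ : ℝ) : jensenGap (1 - δ) (1 + δ) (1 / 2) = evenPart δ := by
  have := jensenGap_eq δ 0
  simpa [entropySeries] using this

lemma oddPart_nonneg {δ : ℝ} (h0 : 0 ≤ δ) (h1 : δ ≤ 1) : 0 ≤ oddPart δ := by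
  rcases h1.eq_or_lt with rfl | h1
  · unfold oddPart entropySeries
    have := Real.log_two_lt_d9
    norm_num; linarith
  · exact (hasSum_oddPart (x := δ) (by rwa [abs_of_nonneg h0])).nonneg fun j => by positivity

lemma entropySeries_nonneg {x : ℝ} (hx : x ≤ 1) : 0 ≤ entropySeries x := by
  rcases hx.eq_or_lt with rfl | hx
  · simp [entropySeries]
  have h := Real.one_sub_inv_le_log_of_pos (x := 1 - x) (by linarith)
  have h2 := mul_le_mul_of_nonneg_left h (show 0 ≤ 1 - x by linarith)
  have h3 : (1 - x) * (1 - (1 - x)⁻¹) = - x := by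
    have : 1 - x ≠ 0 := by linarith
    field_simp; ring
  unfold entropySeries
  linarith

/-- The uniform law loses at most the factor `2 / (e log 2)` in the Jensen gap. -/
theorem jensenGap_le {K : ℝ} (hK : 2 * (Real.exp 1)⁻¹ < K * Real.log 2) (hK1 : 1 ≤ K)
    {u v p : ℝ} (hu : 0 ≤ u) (hv : 0 ≤ v) (h0 : 0 ≤ p) (h1 : p ≤ 1) :
    jensenGap u v p ≤ K * jensenGap u v (1 / 2) := by
  wlog huv : u ≤ v generalizing u v p
  · have := this hv hu (p := 1 - p) (by linarith) (by linarith) (le_of_not_ge huv)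
    rw [jensenGap_symm] at this
    rwa [← jensenGap_symm u v (1 / 2), show (1 : ℝ) - 1 / 2 = 1 / 2 by norm_num]
  rcases huv.eq_or_lt with rfl | huv
  · simp [jensenGap, ← add_mul]
  set a := (u + v) / 2 with ha
  have ha0 : 0 < a := by rw [ha]; linarith
  set δ := (v - u) / (u + v) with hδ
  have hs : u + v ≠ 0 := by linarith
  have hδ0 : 0 < δ := div_pos (by linarith) (by linarith)
  have hδ1 : δ ≤ 1 := (div_le_one (by linarith)).2 (by linarith)
  have eu : u = a * (1 - δ) := by rw [ha, hδ]; field_simp; ring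
  have ev : v = a * (1 + δ) := by rw [ha, hδ]; field_simp; ring
  rw [eu, ev, jensenGap_mul ha0.ne', jensenGap_mul ha0.ne', mul_left_comm]
  refine mul_le_mul_of_nonneg_left ?_ ha0.le
  rw [jensenGap_half_eq]
  have hp : p = (1 - (1 - 2 * p)) / 2 := by ring
  rw [hp, jensenGap_eq]
  -- If the larger value carries at least half of the weight, then `σ = 1 - 2p ≤ 0`: the odd term
  -- and the subtracted term only lower the gap, and `1 ≤ K` suffices.
  rcases le_total (1 / 2) p with hp2 | hp2
  · have hA : 0 ≤ evenPart δ := by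
      rw [← jensenGap_half_eq]
      exact jensenGap_nonneg (by linarith) (by linarith) (by norm_num) (by norm_num)
    have hO := oddPart_nonneg hδ0.le hδ1
    have hE := entropySeries_nonneg (x := (1 - 2 * p) * δ) (by nlinarith)
    nlinarith
  · exact evenPart_add_le hδ0 hδ1 (by linarith) (by linarith) hK

end CompoundChannel

/-! ### Product laws, divergence and the converse. -/

namespace CompoundChannel

open Finset

section ProductSums

variable {Y : Type} [Fintype Y] {n : ℕ}

lemma sum_prod_eq_prod_sum (f : Fin n → Y → ℝ) :
    ∑ y : Fin n → Y, ∏ k, f k (y k) = ∏ k, ∑ b, f k b := by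
  classical
  rw [Finset.prod_univ_sum, Fintype.piFinset_univ]

lemma sum_prod_eq_one {p : Fin n → Y → ℝ} (hp : ∀ k, ∑ b, p k b = 1) :
    ∑ y : Fin n → Y, ∏ k, p k (y k) = 1 := by
  rw [sum_prod_eq_prod_sum]
  exact Finset.prod_eq_one fun k _ => hp k

/-- The expectation of a function of one coordinate under a product law. -/
lemma sum_prod_mul_apply {p : Fin n → Y → ℝ} (hp : ∀ k, ∑ b, p k b = 1) (i : Fin n)
    (h : Y → ℝ) : ∑ y : Fin n → Y, (∏ k, p k (y k)) * h (y i) = ∑ b, p i b * h b := by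
  have e : ∀ y : Fin n → Y, (∏ k, p k (y k)) * h (y i) =
      ∏ k, (p k (y k) * if k = i then h (y k) else 1) := by
    intro y
    rw [Finset.prod_mul_distrib]
    simp
  simp_rw [e]
  rw [sum_prod_eq_prod_sum (fun k b => p k b * if k = i then h b else 1),
    Finset.prod_eq_single i]
  · simp
  · intro k _ hk
    simp [hk, hp k]
  · simp

end ProductSums

/-- The Donsker–Varadhan lower bound on the divergence of `p` from `q`. -/
lemma sum_mul_sub_log_le {ι : Type*} [Fintype ι] {p q φ : ι → ℝ} {Z : ℝ}
    (hp : ∀ i, 0 ≤ p i) (hp1 : ∑ i, p i = 1) (hq : ∀ i, 0 ≤ q i) (hpq : ∀ i, q i = 0 → p i = 0)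
    (hZ : 0 < Z) (hqZ : ∑ i, q i * Real.exp (φ i) ≤ Z) :
    ∑ i, p i * φ i - Real.log Z ≤ ∑ i, p i * Real.log (p i / q i) := by
  -- This is `log t ≤ t - 1` at `t = q e^φ / (p Z)`, weighted by `p`.
  have hterm : ∀ i, p i * φ i - p i * Real.log Z - p i * Real.log (p i / q i) ≤
      q i * Real.exp (φ i) / Z - p i := by
    intro i
    rcases (hp i).eq_or_lt with h | h
    · rw [← h]
      have := hq i
      simp only [zero_mul, sub_zero]
      positivity
    · have hqi : 0 < q i := (hq i).lt_of_ne fun h0 => h.ne' (hpq i h0.symm)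
      have hl := Real.log_le_sub_one_of_pos (x := q i * Real.exp (φ i) / (p i * Z)) (by positivity)
      rw [Real.log_div (by positivity) (by positivity), Real.log_mul hqi.ne' (Real.exp_pos _).ne',
        Real.log_exp, Real.log_mul h.ne' hZ.ne'] at hl
      rw [Real.log_div h.ne' hqi.ne']
      have h2 := mul_le_mul_of_nonneg_left hl h.le
      have h3 : p i * (q i * Real.exp (φ i) / (p i * Z) - 1) = q i * Real.exp (φ i) / Z - p i := by
        field_simp
      linarith
  have hs := Finset.sum_le_sum fun i (_ : i ∈ Finset.univ) => hterm i
  simp only [Finset.sum_sub_distrib, ← Finset.sum_mul, ← Finset.sum_div, hp1] at hs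
  have : (∑ i, q i * Real.exp (φ i)) / Z ≤ 1 := (div_le_one hZ).2 hqZ
  linarith

section Information

variable {X Y : Type} [Fintype X] [Fintype Y]

/-- The output law of the channel `W` under the input law `P`. -/
noncomputable def outputLaw (P : X → ℝ) (W : DMC X Y) (y : Y) : ℝ := ∑ x, P x * W.W x y

/-- The divergence, in nats, of the row `W(·|x)` from the law `Q`. -/
noncomputable def rowDiv {X Y : Type} [Fintype Y] (W : DMC X Y) (Q : Y → ℝ) (x : X) : ℝ :=
  ∑ y, W.W x y * Real.log (W.W x y / Q y)

lemma mutualInfo_eq (P : X → ℝ) (W : DMC X Y) :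
    mutualInfo P W * Real.log 2 = ∑ x, P x * rowDiv W (outputLaw P W) x := by
  have hl : Real.log 2 ≠ 0 := (Real.log_pos one_lt_two).ne'
  unfold mutualInfo rowDiv outputLaw
  rw [Finset.sum_mul]
  refine Finset.sum_congr rfl fun x _ => ?_
  rw [Finset.sum_mul, Finset.mul_sum]
  refine Finset.sum_congr rfl fun y _ => ?_
  rcases eq_or_ne (P x) 0 with h | h
  · simp [h]
  · rw [mul_div_mul_left _ _ h, Real.logb]
    field_simp

lemma outputLaw_nonneg {P : X → ℝ} (hP : P ∈ stdSimplex ℝ X) (W : DMC X Y) (y : Y) :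
    0 ≤ outputLaw P W y :=
  Finset.sum_nonneg fun x _ => mul_nonneg (hP.1 x) (W.nonneg x y)

lemma sum_outputLaw {P : X → ℝ} (hP : P ∈ stdSimplex ℝ X) (W : DMC X Y) :
    ∑ y, outputLaw P W y = 1 := by
  unfold outputLaw
  rw [Finset.sum_comm]
  simp_rw [← Finset.mul_sum, W.sum_eq_one, mul_one]
  exact hP.2

lemma mul_le_outputLaw {P : X → ℝ} (hP : P ∈ stdSimplex ℝ X) (W : DMC X Y) (x : X) (y : Y) :
    P x * W.W x y ≤ outputLaw P W y :=
  Finset.single_le_sum (f := fun x => P x * W.W x y)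
    (fun x _ => mul_nonneg (hP.1 x) (W.nonneg x y)) (Finset.mem_univ x)

lemma blockProb_nonneg {X Y : Type} [Fintype Y] (W : DMC X Y) {n : ℕ}
    (x : Fin n → X) (y : Fin n → Y) :
    0 ≤ W.blockProb x y :=
  Finset.prod_nonneg fun _ _ => W.nonneg _ _

lemma sum_blockProb {X Y : Type} [Fintype Y] (W : DMC X Y) {n : ℕ} (x : Fin n → X) :
    ∑ y, W.blockProb x y = 1 :=
  sum_prod_eq_one (p := fun k b => W.W (x k) b) fun k => W.sum_eq_one (x k)

/-- The factor in front kills the words of probability zero, the only ones where the logarithm of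
the product might not split. -/
lemma blockProb_mul_log {X Y : Type} [Fintype Y] {W : DMC X Y} {Q : Y → ℝ} {n : ℕ}
    {x : Fin n → X}
    (hQ : ∀ i y, Q y = 0 → W.W (x i) y = 0) (y : Fin n → Y) :
    W.blockProb x y * Real.log (W.blockProb x y / ∏ i, Q (y i)) =
      W.blockProb x y * ∑ i, Real.log (W.W (x i) (y i) / Q (y i)) := by
  rcases eq_or_ne (W.blockProb x y) 0 with h | h
  · simp [h]
  · congr 1
    unfold DMC.blockProb at h ⊢
    rw [Finset.prod_ne_zero_iff] at h
    rw [← Finset.prod_div_distrib, Real.log_prod]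
    intro i hi
    exact div_ne_zero (h i hi) fun h0 => h i hi (hQ i _ h0)

lemma sum_blockProb_mul_log {X Y : Type} [Fintype Y] {W : DMC X Y} {Q : Y → ℝ} {n : ℕ}
    {x : Fin n → X}
    (hQ : ∀ i y, Q y = 0 → W.W (x i) y = 0) :
    ∑ y, W.blockProb x y * Real.log (W.blockProb x y / ∏ i, Q (y i)) =
      ∑ i, rowDiv W Q (x i) := by
  simp_rw [blockProb_mul_log hQ, Finset.mul_sum]
  rw [Finset.sum_comm]
  refine Finset.sum_congr rfl fun i _ => ?_
  exact sum_prod_mul_apply (p := fun k b => W.W (x k) b) (fun k => W.sum_eq_one (x k)) i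
    (fun b => Real.log (W.W (x i) b / Q b))

/-- The empirical input law of the whole codebook. -/
noncomputable def codebookLaw {X : Type} [DecidableEq X] {M n : ℕ}
    (F : Fin M → Fin n → X) (x : X) : ℝ :=
  (1 / (M * n : ℝ)) * ∑ m, ∑ i, if F m i = x then 1 else 0

lemma sum_codebookLaw_mul [DecidableEq X] {M n : ℕ} (F : Fin M → Fin n → X) (g : X → ℝ) :
    ∑ x, codebookLaw F x * g x = (1 / (M * n : ℝ)) * ∑ m, ∑ i, g (F m i) := by
  unfold codebookLaw
  simp_rw [mul_assoc, ← Finset.mul_sum, Finset.sum_mul]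
  congr 1
  rw [Finset.sum_comm]
  refine Finset.sum_congr rfl fun m _ => ?_
  rw [Finset.sum_comm]
  refine Finset.sum_congr rfl fun i _ => ?_
  simp

lemma codebookLaw_mem [DecidableEq X] {M n : ℕ} (hM : 0 < M) (hn : 0 < n)
    (F : Fin M → Fin n → X) : codebookLaw F ∈ stdSimplex ℝ X := by
  refine ⟨fun x => ?_, ?_⟩
  · unfold codebookLaw
    refine mul_nonneg (by positivity) (Finset.sum_nonneg fun m _ => Finset.sum_nonneg fun i _ => ?_)
    split_ifs <;> norm_num
  · have := sum_codebookLaw_mul F (fun _ => 1)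
    simp only [mul_one] at this
    rw [this]
    have : (M : ℝ) ≠ 0 := by positivity
    have : (n : ℝ) ≠ 0 := by positivity
    simp
    field_simp

lemma codebookLaw_pos {X : Type} [DecidableEq X] {M n : ℕ} (hM : 0 < M) (hn : 0 < n)
    (F : Fin M → Fin n → X) (m : Fin M) (i : Fin n) : 0 < codebookLaw F (F m i) := by
  unfold codebookLaw
  refine mul_pos (by positivity) ?_
  refine Finset.sum_pos' (fun m' _ => Finset.sum_nonneg fun i' _ => by split_ifs <;> norm_num)
    ⟨m, Finset.mem_univ _, ?_⟩
  exact Finset.sum_pos' (fun i' _ => by split_ifs <;> norm_num) ⟨i, Finset.mem_univ _, by simp⟩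

lemma errorProb_nonneg {X Y : Type} [Fintype Y] {n M : ℕ}
    (F : Fin M → Fin n → X) (G : (Fin n → Y) → Fin M)
    (W : DMC X Y) : 0 ≤ errorProb F G W := by
  refine mul_nonneg (by positivity) (Finset.sum_nonneg fun m _ => Finset.sum_nonneg fun y _ => ?_)
  split_ifs
  · exact le_rfl
  · exact blockProb_nonneg _ _ _

/-- A Fano-type inequality: the codebook law carries almost all of the rate. -/
theorem fano_codebookLaw [DecidableEq X] {M n : ℕ} (hM : 0 < M) (hn : 0 < n)
    (F : Fin M → Fin n → X) (G : (Fin n → Y) → Fin M) (W : DMC X Y) (K : ℝ) :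
    (1 - errorProb F G W) * (Real.log M + K) - Real.log (1 + Real.exp K) ≤
      n * (mutualInfo (codebookLaw F) W * Real.log 2) := by
  set P := codebookLaw F with hPdef
  have hP : P ∈ stdSimplex ℝ X := codebookLaw_mem hM hn F
  set Q := outputLaw P W with hQdef
  have hM0 : (0 : ℝ) < M := by exact_mod_cast hM
  have hn0 : (0 : ℝ) < n := by exact_mod_cast hn
  have hac : ∀ m i y, Q y = 0 → W.W (F m i) y = 0 := by
    intro m i y h
    have h1 := mul_le_outputLaw hP W (F m i) y
    have h2 := codebookLaw_pos hM hn F m i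
    rw [← hPdef] at h2
    rw [← hQdef, h] at h1
    have h3 := W.nonneg (F m i) y
    by_contra hne
    have := mul_pos h2 (h3.lt_of_ne (Ne.symm hne))
    linarith
  have hQ1 : ∑ y : Fin n → Y, ∏ i, Q (y i) = 1 :=
    sum_prod_eq_one (p := fun _ => Q) fun _ => sum_outputLaw hP W
  have hQn : ∀ y : Fin n → Y, 0 ≤ ∏ i, Q (y i) := fun y =>
    Finset.prod_nonneg fun i _ => outputLaw_nonneg hP W _
  -- The joint law of message and output is tested against a uniform message and an independent
  -- output of law `Qⁿ`. Under the latter, decoding is correct with probability `1 / M`, so a reward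
  -- `log M + K` for correct decoding has exponential moment at most `1 + e^K`.
  have key := sum_mul_sub_log_le (ι := Fin M × (Fin n → Y))
    (p := fun z => (1 / (M : ℝ)) * W.blockProb (F z.1) z.2)
    (q := fun z => (1 / (M : ℝ)) * ∏ i, Q (z.2 i))
    (φ := fun z => if G z.2 = z.1 then Real.log M + K else 0) (Z := 1 + Real.exp K)
    (fun z => mul_nonneg (by positivity) (blockProb_nonneg _ _ _)) ?_
    (fun z => mul_nonneg (by positivity) (hQn _)) ?_ (by positivity) ?_
  · have e1 : ∑ z : Fin M × (Fin n → Y), (1 / (M : ℝ)) * W.blockProb (F z.1) z.2 *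
        (if G z.2 = z.1 then Real.log M + K else 0) =
        (1 - errorProb F G W) * (Real.log M + K) := by
      have hone : (1 : ℝ) = (1 / (M : ℝ)) * ∑ m, ∑ y, W.blockProb (F m) y := by
        simp_rw [sum_blockProb]; simp [hM0.ne']
      unfold errorProb
      nth_rewrite 2 [hone]
      rw [Fintype.sum_prod_type, ← mul_sub, ← Finset.sum_sub_distrib, mul_assoc, Finset.sum_mul,
        Finset.mul_sum]
      refine Finset.sum_congr rfl fun m _ => ?_
      rw [← Finset.sum_sub_distrib, Finset.sum_mul, Finset.mul_sum]
      refine Finset.sum_congr rfl fun y _ => ?_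
      split_ifs <;> ring
    -- As `Q` is the output law of the codebook law, this divergence is exactly `n` times the mutual
    -- information; no concavity is needed.
    have e2 : ∑ z : Fin M × (Fin n → Y), (1 / (M : ℝ)) * W.blockProb (F z.1) z.2 *
        Real.log ((1 / (M : ℝ)) * W.blockProb (F z.1) z.2 / ((1 / (M : ℝ)) * ∏ i, Q (z.2 i))) =
        n * (mutualInfo P W * Real.log 2) := by
      rw [mutualInfo_eq, sum_codebookLaw_mul, Fintype.sum_prod_type]
      have : ∀ m : Fin M, ∑ y : Fin n → Y, (1 / (M : ℝ)) * W.blockProb (F m) y *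
          Real.log ((1 / (M : ℝ)) * W.blockProb (F m) y / ((1 / (M : ℝ)) * ∏ i, Q (y i))) =
          (1 / (M : ℝ)) * ∑ i, rowDiv W Q (F m i) := by
        intro m
        rw [← sum_blockProb_mul_log (hac m), Finset.mul_sum]
        refine Finset.sum_congr rfl fun y _ => ?_
        rw [mul_div_mul_left _ _ (by positivity), mul_assoc]
      simp_rw [this]
      rw [← Finset.mul_sum, ← mul_assoc]
      congr 1
      field_simp
    rw [e1, e2] at key
    exact key
  · rw [Fintype.sum_prod_type]
    simp_rw [← Finset.mul_sum, sum_blockProb]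
    simp [hM0.ne']
  · intro z hz
    have hz' : ∏ i, Q (z.2 i) = 0 := by
      rcases mul_eq_zero.1 hz with h | h
      · exact absurd h (by positivity)
      · exact h
    obtain ⟨i, _, hi⟩ := Finset.prod_eq_zero_iff.1 hz'
    have : W.blockProb (F z.1) z.2 = 0 :=
      Finset.prod_eq_zero (Finset.mem_univ i) (hac z.1 i _ hi)
    simp [this]
  · have hle : ∀ z : Fin M × (Fin n → Y), (1 / (M : ℝ)) * (∏ i, Q (z.2 i)) *
        Real.exp (if G z.2 = z.1 then Real.log M + K else 0) ≤
        (1 / (M : ℝ)) * (∏ i, Q (z.2 i)) * (1 + if G z.2 = z.1 then M * Real.exp K else 0) := by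
      intro z
      refine mul_le_mul_of_nonneg_left ?_ (mul_nonneg (by positivity) (hQn _))
      split_ifs
      · rw [Real.exp_add, Real.exp_log hM0]; linarith
      · simp
    refine (Finset.sum_le_sum fun z _ => hle z).trans (le_of_eq ?_)
    rw [Fintype.sum_prod_type_right]
    have : ∀ y : Fin n → Y, ∑ m : Fin M, (1 / (M : ℝ)) * (∏ i, Q (y i)) *
        (1 + if G y = m then M * Real.exp K else 0) = (∏ i, Q (y i)) * (1 + Real.exp K) := by
      intro y
      rw [← Finset.mul_sum, Finset.sum_add_distrib]
      simp
      field_simp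
    simp_rw [this]
    rw [← Finset.sum_mul, hQ1, one_mul]

/-- The converse: one input law carries an achievable rate on all channels of the set. -/
theorem Achievable.exists_le_mutualInfo {S : Set (DMC X Y)} {R : ℝ} (hR : Achievable S R)
    {η : ℝ} (hη : 0 < η) :
    ∃ P ∈ stdSimplex ℝ X, ∀ W ∈ S, R ≤ mutualInfo P W + η := by
  classical
  -- Nothing makes the block length large, so the additive Fano loss must itself be small. It is at
  -- most `ε K + e^(-K)`: `K` controls the second term, and `ε` is then chosen for the first.
  set K : ℝ := 4 / η with hK
  have hK0 : 0 < K := by positivity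
  set ε : ℝ := min (1 / 2) (η / (4 * (|R| + 2 * K + 1))) with hε
  have hε0 : 0 < ε := lt_min (by norm_num) (by positivity)
  have hε1 : ε ≤ 1 / 2 := min_le_left _ _
  have hε2 : ε * (|R| + 2 * K + 1) ≤ η / 4 := by
    have : ε ≤ η / (4 * (|R| + 2 * K + 1)) := min_le_right _ _
    rw [le_div_iff₀ (by positivity)] at this
    linarith
  obtain ⟨n, M, hn, hM, F, G, hFG⟩ := hR ε hε0
  have hM0 : (0 : ℝ) < M := lt_of_lt_of_le (by positivity) hM
  have hMn : 0 < M := by exact_mod_cast hM0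
  have hn1 : (1 : ℝ) ≤ n := by exact_mod_cast hn
  refine ⟨codebookLaw F, codebookLaw_mem hMn hn F, fun W hW => ?_⟩
  have hf := fano_codebookLaw hMn hn F G W K
  have he0 := errorProb_nonneg F G W
  have he := hFG W hW
  set e := errorProb F G W
  set I := mutualInfo (codebookLaw F) W
  have hlogM : n * R * Real.log 2 ≤ Real.log M := by
    have := Real.log_le_log (by positivity) hM
    rwa [Real.log_rpow (by norm_num)] at this
  have hlogM0 : 0 ≤ Real.log M := Real.log_nonneg (by exact_mod_cast hMn)
  have hl2 : 1 / 2 < Real.log 2 := by have := Real.log_two_gt_d9; linarith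
  have hexp : Real.log (1 + Real.exp K) ≤ K + Real.exp (-K) := by
    have e1 : 1 + Real.exp K = Real.exp K * (1 + Real.exp (-K)) := by
      rw [mul_add, ← Real.exp_add]; simp [add_comm]
    rw [e1, Real.log_mul (by positivity) (by positivity), Real.log_exp]
    have := Real.log_le_sub_one_of_pos (x := 1 + Real.exp (-K)) (by positivity)
    linarith
  have hexp2 : Real.exp (-K) ≤ η / 4 := by
    rw [Real.exp_neg, show η / 4 = K⁻¹ by rw [hK, inv_div]]
    have := Real.add_one_le_exp K
    exact inv_anti₀ hK0 (by linarith)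
  have s1 : (1 - ε) * (n * R * Real.log 2) ≤ (1 - e) * Real.log M :=
    (mul_le_mul_of_nonneg_left hlogM (by linarith)).trans
      (mul_le_mul_of_nonneg_right (by linarith) hlogM0)
  have s2 : e * K ≤ ε * K := mul_le_mul_of_nonneg_right he.le hK0.le
  have s3 : (1 - ε) * (n * R * Real.log 2) - ε * K - η / 4 ≤ n * (I * Real.log 2) := by
    nlinarith
  have s4 : n * (ε * |R| * Real.log 2) ≥ n * (ε * R * Real.log 2) := by
    have := le_abs_self R
    gcongr
  have s5 : ε * K + η / 4 ≤ n * (ε * K + η / 4) := le_mul_of_one_le_left (by positivity) hn1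
  have s6 : n * (R * Real.log 2 - ε * |R| * Real.log 2 - (ε * K + η / 4)) ≤
      n * (I * Real.log 2) := by nlinarith
  have s7 := le_of_mul_le_mul_left s6 (by linarith)
  have s8 : ε * K + η / 4 ≤ (2 * ε * K + η / 2) * Real.log 2 := by
    have : 0 < ε * K := by positivity
    nlinarith
  have s9 : R * Real.log 2 ≤ (I + ε * |R| + 2 * ε * K + η / 2) * Real.log 2 := by linarith
  have s10 := le_of_mul_le_mul_right s9 (by linarith)
  nlinarith

end Information

/-! ### Binary mutual information as a sum of Jensen gaps. -/

lemma mutualInfo_eq_jensenGap {P : Bool → ℝ} (hP : P ∈ stdSimplex ℝ Bool) (W : BMC) :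
    mutualInfo P W * Real.log 2 =
      ∑ y, jensenGap (W.W false y) (W.W true y) (P true) := by
  have h1 : P false = 1 - P true := by
    have := hP.2
    rw [Fintype.sum_bool] at this
    linarith
  rw [mutualInfo_eq]
  unfold rowDiv
  simp_rw [Finset.mul_sum]
  rw [Finset.sum_comm]
  refine Finset.sum_congr rfl fun y _ => ?_
  have hQ : outputLaw P W y = (1 - P true) * W.W false y + P true * W.W true y := by
    unfold outputLaw
    rw [Fintype.sum_bool, h1]; ring
  have hterm : ∀ x, P x * (W.W x y * Real.log (W.W x y / outputLaw P W y)) =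
      P x * (W.W x y * Real.log (W.W x y)) - P x * W.W x y * Real.log (outputLaw P W y) := by
    intro x
    rcases (mul_nonneg (hP.1 x) (W.nonneg x y)).eq_or_lt with h | h
    · rcases mul_eq_zero.1 h.symm with h | h <;> simp [h]
    · have hQ0 := h.trans_le (mul_le_outputLaw hP W x y)
      have hW : W.W x y ≠ 0 := fun h0 => by simp [h0] at h
      rw [Real.log_div hW hQ0.ne']; ring
  rw [Fintype.sum_bool, hterm, hterm, hQ, h1]
  unfold jensenGap
  ring

lemma uniformInput_mem : uniformInput ∈ stdSimplex ℝ Bool :=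
  ⟨fun _ => by norm_num [uniformInput], by norm_num [uniformInput]⟩

lemma mem_unit_of_mem_stdSimplex {P : Bool → ℝ} (hP : P ∈ stdSimplex ℝ Bool) :
    0 ≤ P true ∧ P true ≤ 1 := by
  have := hP.2
  rw [Fintype.sum_bool] at this
  exact ⟨hP.1 true, by linarith [hP.1 false]⟩

lemma mutualInfo_nonneg {P : Bool → ℝ} (hP : P ∈ stdSimplex ℝ Bool) (W : BMC) :
    0 ≤ mutualInfo P W := by
  have hp := mem_unit_of_mem_stdSimplex hP
  refine nonneg_of_mul_nonneg_left (b := Real.log 2) ?_ (Real.log_pos one_lt_two)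
  rw [mutualInfo_eq_jensenGap hP]
  exact Finset.sum_nonneg fun y _ => jensenGap_nonneg (W.nonneg _ _) (W.nonneg _ _) hp.1 hp.2

/-- The uniform law attains more than `94.2%` of the mutual information of any other law. -/
theorem mutualInfo_le_uniformInput {P : Bool → ℝ} (hP : P ∈ stdSimplex ℝ Bool) (W : BMC) :
    (94205 / 100000) * mutualInfo P W ≤ mutualInfo uniformInput W := by
  have hp := mem_unit_of_mem_stdSimplex hP
  -- The constant `0.94205` lies below `e log 2 / 2` and strictly above `0.942`; the second margin
  -- later provides the rate gap of the direct part.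
  have hK : 2 * (Real.exp 1)⁻¹ < (100000 / 94205 : ℝ) * Real.log 2 := by
    have h1 := Real.exp_one_gt_d9
    have h2 := Real.log_two_gt_d9
    rw [← div_eq_mul_inv, div_lt_iff₀ (by positivity)]
    nlinarith
  have h : mutualInfo P W * Real.log 2 ≤
      (100000 / 94205 : ℝ) * (mutualInfo uniformInput W * Real.log 2) := by
    rw [mutualInfo_eq_jensenGap hP, mutualInfo_eq_jensenGap uniformInput_mem, Finset.mul_sum]
    exact Finset.sum_le_sum fun y _ =>
      jensenGap_le hK (by norm_num) (W.nonneg _ _) (W.nonneg _ _) hp.1 hp.2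
  rw [← mul_assoc] at h
  have := le_of_mul_le_mul_right h (Real.log_pos one_lt_two)
  linarith

end CompoundChannel

/-! ### Concentration of the information density. -/

namespace CompoundChannel

open Finset

section SecondMoment

variable {Y : Type} [Fintype Y] {n : ℕ}

/-- The second moment of a sum of independent centred variables. -/
lemma sum_prod_mul_sq {p z : Fin n → Y → ℝ} (hp : ∀ k, ∑ b, p k b = 1)
    (hz : ∀ k, ∑ b, p k b * z k b = 0) :
    ∑ y : Fin n → Y, (∏ k, p k (y k)) * (∑ i, z i (y i)) ^ 2 =
      ∑ i, ∑ b, p i b * z i b ^ 2 := by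
  have hcross : ∀ i j, ∑ y : Fin n → Y, (∏ k, p k (y k)) * (z i (y i) * z j (y j)) =
      if i = j then ∑ b, p i b * z i b ^ 2 else 0 := by
    intro i j
    split_ifs with hij
    · subst hij
      rw [← sum_prod_mul_apply hp i (fun b => z i b ^ 2)]
      exact Finset.sum_congr rfl fun y _ => by ring
    · have e : ∀ y : Fin n → Y, (∏ k, p k (y k)) * (z i (y i) * z j (y j)) =
          ∏ k, (p k (y k) * ((if k = i then z k (y k) else 1) *
            (if k = j then z k (y k) else 1))) := by
        intro y
        rw [Finset.prod_mul_distrib, Finset.prod_mul_distrib]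
        simp
      simp_rw [e]
      rw [sum_prod_eq_prod_sum (fun k b => p k b * ((if k = i then z k b else 1) *
            (if k = j then z k b else 1)))]
      refine Finset.prod_eq_zero (Finset.mem_univ i) ?_
      simp [hij, hz]
  simp_rw [sq (∑ i, z i _), Finset.sum_mul_sum, Finset.mul_sum]
  rw [Finset.sum_comm]
  refine Finset.sum_congr rfl fun i _ => ?_
  rw [Finset.sum_comm]
  simp_rw [hcross]
  simp

end SecondMoment

/-- Meant for the ratio of a channel entry to the uniform output law, which never exceeds `2`; it
bounds the variance uniformly over all channels. -/
lemma mul_log_sq_le {r : ℝ} (h0 : 0 ≤ r) (h2 : r ≤ 2) : r * Real.log r ^ 2 ≤ 4 := by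
  rcases h0.eq_or_lt with rfl | h0
  · simp
  rcases le_total r 1 with h1 | h1
  · have h := Real.abs_log_mul_self_rpow_lt r (1 / 2) h0 h1 (by norm_num)
    rw [← Real.sqrt_eq_rpow] at h
    have h3 : (Real.log r * √r) ^ 2 ≤ 2 ^ 2 := by
      rw [← sq_abs]
      exact pow_le_pow_left₀ (abs_nonneg _) (by linarith) 2
    rw [mul_pow, Real.sq_sqrt h0.le] at h3
    linarith
  · have hl0 := Real.log_nonneg h1
    have hl1 : Real.log r ≤ 1 := by
      have := Real.log_le_sub_one_of_pos h0
      linarith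
    have : Real.log r ^ 2 ≤ 1 := pow_le_one₀ hl0 hl1
    nlinarith

section Deviation

/-- The output law of `W` under the uniform input law. -/
noncomputable def unifOut (W : BMC) : Bool → ℝ := outputLaw uniformInput W

lemma unifOut_nonneg (W : BMC) (y : Bool) : 0 ≤ unifOut W y := outputLaw_nonneg uniformInput_mem W y

lemma le_two_mul_unifOut (W : BMC) (x y : Bool) : W.W x y ≤ 2 * unifOut W y := by
  have := mul_le_outputLaw uniformInput_mem W x y
  unfold uniformInput at this
  unfold unifOut uniformInput
  linarith

lemma sum_eq_two_mul_unifOut (W : BMC) (y : Bool) : ∑ x, W.W x y = 2 * unifOut W y := by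
  unfold unifOut outputLaw uniformInput
  simp only [Fintype.sum_bool]
  ring

lemma unifOut_le_one (W : BMC) (y : Bool) : unifOut W y ≤ 1 := by
  rw [← sum_outputLaw uniformInput_mem W]
  exact Finset.single_le_sum (f := fun y => unifOut W y) (fun y _ => unifOut_nonneg W y)
    (Finset.mem_univ y)

lemma eq_zero_of_unifOut_eq_zero {W : BMC} {y : Bool} (h : unifOut W y = 0) (x : Bool) :
    W.W x y = 0 := by
  have := le_two_mul_unifOut W x y
  have := W.nonneg x y
  linarith

lemma mul_log_ratio_sq_le (W : BMC) (x y : Bool) :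
    W.W x y * Real.log (W.W x y / unifOut W y) ^ 2 ≤ 4 := by
  rcases (unifOut_nonneg W y).eq_or_lt with h | h
  · simp [eq_zero_of_unifOut_eq_zero h.symm]
  have h1 := mul_log_sq_le (r := W.W x y / unifOut W y) (div_nonneg (W.nonneg _ _) h.le)
    ((div_le_iff₀ h).2 (le_two_mul_unifOut W x y))
  calc W.W x y * Real.log (W.W x y / unifOut W y) ^ 2
      = unifOut W y * (W.W x y / unifOut W y * Real.log (W.W x y / unifOut W y) ^ 2) := by
        field_simp
    _ ≤ unifOut W y * 4 := mul_le_mul_of_nonneg_left h1 h.le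
    _ ≤ 4 := by linarith [unifOut_le_one W y]

/-- The variance of the information density of a word is at most `8` per letter. -/
lemma sum_blockProb_mul_sq_le (W : BMC) {n : ℕ} (x : Fin n → Bool) :
    ∑ y, W.blockProb x y * (∑ i, (Real.log (W.W (x i) (y i) / unifOut W (y i)) -
      rowDiv W (unifOut W) (x i))) ^ 2 ≤ 8 * n := by
  have hp : ∀ k, ∑ b, W.W (x k) b = 1 := fun k => W.sum_eq_one (x k)
  have h := sum_prod_mul_sq (p := fun k b => W.W (x k) b)
    (z := fun k b => Real.log (W.W (x k) b / unifOut W b) - rowDiv W (unifOut W) (x k)) hp ?_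
  · unfold DMC.blockProb
    rw [h]
    have hb : ∀ i, ∑ b, W.W (x i) b * (Real.log (W.W (x i) b / unifOut W b) -
        rowDiv W (unifOut W) (x i)) ^ 2 ≤ 8 := by
      intro i
      have e : ∑ b, W.W (x i) b * (Real.log (W.W (x i) b / unifOut W b) -
        rowDiv W (unifOut W) (x i)) ^ 2 =
          ∑ b, W.W (x i) b * Real.log (W.W (x i) b / unifOut W b) ^ 2 -
            rowDiv W (unifOut W) (x i) ^ 2 := by
        have h1 : rowDiv W (unifOut W) (x i) =
          ∑ b, W.W (x i) b * Real.log (W.W (x i) b / unifOut W b) := rfl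
        have h2 := hp i
        rw [Fintype.sum_bool] at h1 h2 ⊢
        rw [Fintype.sum_bool]
        set D := rowDiv W (unifOut W) (x i)
        linear_combination (-2 * D) * (-h1) + D ^ 2 * h2
      rw [e]
      have := mul_log_ratio_sq_le W (x i)
      have s := sq_nonneg (rowDiv W (unifOut W) (x i))
      rw [Fintype.sum_bool]
      linarith [this true, this false]
    calc _ ≤ ∑ i : Fin n, (8 : ℝ) := Finset.sum_le_sum fun i _ => hb i
      _ = 8 * n := by simp [mul_comm]
  · intro k
    simp_rw [mul_sub, Finset.sum_sub_distrib, ← Finset.sum_mul]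
    rw [hp k, one_mul]
    exact sub_self _

/-- Chebyshev's bound: the information density of a word is rarely below its mean. -/
lemma sum_blockProb_lt_le (W : BMC) {n : ℕ} (hn : 0 < n) (x : Fin n → Bool) {Δ L : ℝ} (hΔ : 0 < Δ)
    (hL : L + n * Δ ≤ ∑ i, rowDiv W (unifOut W) (x i)) :
    ∑ y with W.blockProb x y < Real.exp L * ∏ i, unifOut W (y i), W.blockProb x y ≤
      8 / (n * Δ ^ 2) := by
  have hn0 : (0 : ℝ) < n := by exact_mod_cast hn
  have h := sum_blockProb_mul_sq_le W x
  rw [le_div_iff₀ (by positivity)]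
  have hsub : ∑ y with W.blockProb x y < Real.exp L * ∏ i, unifOut W (y i),
      W.blockProb x y * (n * Δ) ^ 2 ≤ ∑ y, W.blockProb x y *
      (∑ i, (Real.log (W.W (x i) (y i) / unifOut W (y i)) - rowDiv W (unifOut W) (x i))) ^ 2 := by
    refine (Finset.sum_le_sum fun y hy => ?_).trans
      (Finset.sum_le_sum_of_subset_of_nonneg (Finset.filter_subset _ _) fun y _ _ =>
        mul_nonneg (blockProb_nonneg _ _ _) (sq_nonneg _))
    rw [Finset.mem_filter] at hy
    rcases (blockProb_nonneg W x y).eq_or_lt with h0 | h0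
    · simp [← h0]
    have hQ : 0 < ∏ i, unifOut W (y i) := by
      by_contra hc
      have := Real.exp_pos L
      nlinarith [hy.2]
    have hlog := blockProb_mul_log (W := W) (Q := unifOut W) (x := x)
      (fun i y hy => eq_zero_of_unifOut_eq_zero hy _) y
    have hlog' := mul_left_cancel₀ h0.ne' hlog
    have hlt : Real.log (W.blockProb x y / ∏ i, unifOut W (y i)) < L := by
      rw [Real.log_lt_iff_lt_exp (by positivity), div_lt_iff₀ hQ]
      exact hy.2
    refine mul_le_mul_of_nonneg_left ?_ h0.le
    rw [Finset.sum_sub_distrib, ← hlog']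
    have : n * Δ ≤ -(Real.log (W.blockProb x y / ∏ i, unifOut W (y i)) -
      ∑ i, rowDiv W (unifOut W) (x i)) := by linarith
    rw [← neg_sq (Real.log _ - _)]
    exact pow_le_pow_left₀ (by positivity) this 2
  rw [← Finset.sum_mul] at hsub
  have := hsub.trans h
  rw [mul_pow, sq (n : ℝ)] at this
  have h3 : (∑ y with W.blockProb x y < Real.exp L * ∏ i, unifOut W (y i), W.blockProb x y) *
      (n * Δ ^ 2) * n ≤ 8 * n := by linarith
  exact le_of_mul_le_mul_right h3 hn0

end Deviation

/-! ### Joint types, balanced words and the two Hamming metrics. -/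

section JointType

/-- The joint type of two binary words. -/
def jointType {n : ℕ} (x y : Fin n → Bool) (p : Bool × Bool) : ℕ := #{i | (x i, y i) = p}

lemma blockProb_eq_jointType (W : BMC) {n : ℕ} (x y : Fin n → Bool) :
    W.blockProb x y = ∏ p : Bool × Bool, W.W p.1 p.2 ^ jointType x y p := by
  unfold DMC.blockProb jointType
  rw [← Finset.prod_fiberwise' Finset.univ (fun i => (x i, y i)) (fun p => W.W p.1 p.2)]
  simp

lemma sum_eq_jointType {n : ℕ} (x y : Fin n → Bool) (g : Bool × Bool → ℕ) :
    ∑ i, g (x i, y i) = ∑ p : Bool × Bool, jointType x y p * g p := by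
  unfold jointType
  rw [← Finset.sum_fiberwise' Finset.univ (fun i => (x i, y i)) g]
  simp

/-- The number of places where two words agree. -/
def agreement {n : ℕ} (x y : Fin n → Bool) : ℕ := ∑ i, if x i = y i then 1 else 0

/-- The complementary word. -/
def complement {n : ℕ} (x : Fin n → Bool) : Fin n → Bool := fun i => !x i

lemma complement_complement {n : ℕ} (x : Fin n → Bool) : complement (complement x) = x := by
  funext i; simp [complement]

/-- The words of length `2 N` with as many ones as zeros. -/
def balanced (N : ℕ) : Finset (Fin (2 * N) → Bool) :=
  {x | ∑ i, (if x i = true then 1 else 0) = N}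

lemma agreement_eq {n : ℕ} (x y : Fin n → Bool) :
    agreement x y = jointType x y (true, true) + jointType x y (false, false) := by
  unfold agreement
  rw [sum_eq_jointType x y (fun p => if p.1 = p.2 then 1 else 0)]
  simp [Fintype.sum_prod_type]

lemma agreement_complement_eq {n : ℕ} (x y : Fin n → Bool) :
    agreement (complement x) y = jointType x y (true, false) + jointType x y (false, true) := by
  unfold agreement complement
  rw [sum_eq_jointType x y (fun p => if (!p.1) = p.2 then 1 else 0)]
  simp [Fintype.sum_prod_type]

lemma sum_jointType {n : ℕ} (x y : Fin n → Bool) :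
    jointType x y (true, true) + jointType x y (true, false) + jointType x y (false, true) +
      jointType x y (false, false) = n := by
  have := sum_eq_jointType x y (fun _ => 1)
  simp [Fintype.sum_prod_type] at this
  omega

lemma jointType_left {n : ℕ} (x y : Fin n → Bool) :
    jointType x y (true, true) + jointType x y (true, false) =
      ∑ i, if x i = true then 1 else 0 := by
  rw [sum_eq_jointType x y (fun p => if p.1 = true then 1 else 0)]
  simp [Fintype.sum_prod_type]

lemma jointType_right {n : ℕ} (x y : Fin n → Bool) :
    jointType x y (true, true) + jointType x y (false, true) =
      ∑ i, if y i = true then 1 else 0 := by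
  rw [sum_eq_jointType x y (fun p => if p.2 = true then 1 else 0)]
  simp [Fintype.sum_prod_type]

lemma mem_balanced {N : ℕ} {x : Fin (2 * N) → Bool} :
    x ∈ balanced N ↔ ∑ i, (if x i = true then 1 else 0) = N := by
  simp [balanced]

lemma complement_mem_balanced {N : ℕ} {x : Fin (2 * N) → Bool} (hx : x ∈ balanced N) :
    complement x ∈ balanced N := by
  rw [mem_balanced] at hx ⊢
  have h1 := jointType_left x x
  have h2 := sum_jointType x x
  have h3 : ∑ i, (if complement x i = true then 1 else 0) =
      jointType x x (false, true) + jointType x x (false, false) := by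
    unfold complement
    rw [sum_eq_jointType x x (fun p => if (!p.1) = true then 1 else 0)]
    simp [Fintype.sum_prod_type]
  omega

/-- Shifting `e` counts trades `(a (1 - b)) ^ e` for `(b (1 - a)) ^ e`, and `a (1 - b) ≤ b (1 - a)`
is `a ≤ b`. -/
lemma pow_mul_pow_shift_le {a b : ℝ} (ha0 : 0 ≤ a) (ha1 : a ≤ 1) (hb1 : b ≤ 1) (hab : a ≤ b)
    (i j k l e : ℕ) :
    b ^ i * (1 - b) ^ (j + e) * (a ^ (k + e) * (1 - a) ^ l) ≤
      b ^ (i + e) * (1 - b) ^ j * (a ^ k * (1 - a) ^ (l + e)) := by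
  have hb0 : 0 ≤ b := ha0.trans hab
  have h1 : 0 ≤ 1 - a := by linarith
  have h2 : 0 ≤ 1 - b := by linarith
  have h : (a * (1 - b)) ^ e ≤ (b * (1 - a)) ^ e :=
    pow_le_pow_left₀ (mul_nonneg ha0 h2) (by linarith) e
  have hc : 0 ≤ b ^ i * (1 - b) ^ j * (a ^ k * (1 - a) ^ l) := by positivity
  calc b ^ i * (1 - b) ^ (j + e) * (a ^ (k + e) * (1 - a) ^ l)
      = b ^ i * (1 - b) ^ j * (a ^ k * (1 - a) ^ l) * (a * (1 - b)) ^ e := by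
        rw [mul_pow]; ring
    _ ≤ b ^ i * (1 - b) ^ j * (a ^ k * (1 - a) ^ l) * (b * (1 - a)) ^ e :=
        mul_le_mul_of_nonneg_left h hc
    _ = _ := by rw [mul_pow]; ring

lemma W_false_eq (W : BMC) (x : Bool) : W.W x false = 1 - W.W x true := by
  have := W.sum_eq_one x
  rw [Fintype.sum_bool] at this
  linarith

lemma W_le_one (W : BMC) (x : Bool) : W.W x true ≤ 1 := by
  have := W_false_eq W x
  have := W.nonneg x false
  linarith

lemma blockProb_eq_pow (W : BMC) {n : ℕ} (x y : Fin n → Bool) :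
    W.blockProb x y = W.W true true ^ jointType x y (true, true) *
      (1 - W.W true true) ^ jointType x y (true, false) *
      (W.W false true ^ jointType x y (false, true) *
      (1 - W.W false true) ^ jointType x y (false, false)) := by
  rw [blockProb_eq_jointType]
  simp [Fintype.prod_prod_type, W_false_eq]

variable {N : ℕ} {x x' y : Fin (2 * N) → Bool}

/-- For balanced words the likelihood is monotone in the agreement. -/
lemma blockProb_le_of_agreement_le {W : BMC} (hW : W.W false true ≤ W.W true true)
    (hx : x ∈ balanced N) (hx' : x' ∈ balanced N) (h : agreement x y ≤ agreement x' y) :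
    W.blockProb x y ≤ W.blockProb x' y := by
  rw [mem_balanced] at hx hx'
  have a1 := jointType_left x y
  have a2 := jointType_right x y
  have a3 := sum_jointType x y
  have b1 := jointType_left x' y
  have b2 := jointType_right x' y
  have b3 := sum_jointType x' y
  rw [agreement_eq, agreement_eq] at h
  rw [blockProb_eq_pow, blockProb_eq_pow]
  -- Both words have `N` ones, so the two joint types have the same marginals and differ by one
  -- number `e` in all four entries.
  obtain ⟨e, he⟩ : ∃ e, jointType x' y (true, true) = jointType x y (true, true) + e :=
    ⟨jointType x' y (true, true) - jointType x y (true, true), by omega⟩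
  rw [he, show jointType x y (true, false) = jointType x' y (true, false) + e by omega,
    show jointType x y (false, true) = jointType x' y (false, true) + e by omega,
    show jointType x' y (false, false) = jointType x y (false, false) + e by omega]
  exact pow_mul_pow_shift_le (W.nonneg _ _) (W_le_one _ _) (W_le_one _ _) hW _ _ _ _ _

/-- For balanced words the likelihood is monotone in the disagreement. -/
lemma blockProb_le_of_disagreement_le {W : BMC} (hW : W.W true true ≤ W.W false true)
    (hx : x ∈ balanced N) (hx' : x' ∈ balanced N)
    (h : agreement (complement x) y ≤ agreement (complement x') y) :
    W.blockProb x y ≤ W.blockProb x' y := by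
  rw [mem_balanced] at hx hx'
  have a1 := jointType_left x y
  have a2 := jointType_right x y
  have a3 := sum_jointType x y
  have b1 := jointType_left x' y
  have b2 := jointType_right x' y
  have b3 := sum_jointType x' y
  rw [agreement_complement_eq, agreement_complement_eq] at h
  rw [blockProb_eq_pow, blockProb_eq_pow]
  obtain ⟨e, he⟩ : ∃ e, jointType x' y (false, true) = jointType x y (false, true) + e :=
    ⟨jointType x' y (false, true) - jointType x y (false, true), by omega⟩
  rw [he, show jointType x y (false, false) = jointType x' y (false, false) + e by omega,
    show jointType x y (true, true) = jointType x' y (true, true) + e by omega,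
    show jointType x' y (true, false) = jointType x y (true, false) + e by omega]
  refine (le_of_eq_of_le (mul_comm _ _) ?_).trans_eq (mul_comm _ _)
  exact pow_mul_pow_shift_le (W.nonneg _ _) (W_le_one _ _) (W_le_one _ _) hW _ _ _ _ _

/-- The two metrics: agreement and disagreement of letters. -/
noncomputable def hammingMetrics (k : Fin 2) (x y : Bool) : ℝ :=
  if k = 0 then (if x = y then 1 else 0) else (if (!x) = y then 1 else 0)

lemma score_hammingMetrics {n : ℕ} (x y : Fin n → Bool) :
    score hammingMetrics x y = max (agreement x y : ℝ) (agreement (complement x) y) := by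
  have h0 : ∑ i, hammingMetrics 0 (x i) (y i) = (agreement x y : ℝ) := by
    simp [hammingMetrics, agreement]
  have h1 : ∑ i, hammingMetrics 1 (x i) (y i) = (agreement (complement x) y : ℝ) := by
    simp [hammingMetrics, agreement, complement]
  unfold score
  apply le_antisymm
  · refine ciSup_le fun k => ?_
    fin_cases k
    · exact h0.le.trans (le_max_left _ _)
    · exact h1.le.trans (le_max_right _ _)
  · have hb : BddAbove (Set.range fun k : Fin 2 => ∑ i, hammingMetrics k (x i) (y i)) :=
      (Set.finite_range _).bddAbove
    exact max_le (h0.ge.trans (le_ciSup hb 0)) (h1.ge.trans (le_ciSup hb 1))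

/-- A balanced competitor with a higher score is more likely, possibly after complementation. -/
lemma blockProb_le_of_score_le (W : BMC) (hx : x ∈ balanced N) (hx' : x' ∈ balanced N)
    (h : score hammingMetrics x y ≤ score hammingMetrics x' y) :
    W.blockProb x y ≤ W.blockProb x' y ∨ W.blockProb x y ≤ W.blockProb (complement x') y := by
  rw [score_hammingMetrics, score_hammingMetrics] at h
  have hcx' := complement_mem_balanced hx'
  have hm := max_le_iff.1 h
  -- The channel decides which count governs its likelihood. That count for `x` is at most the score
  -- of `x'`, which is attained by the same count for `x'` or for its complement.
  rcases le_total (W.W false true) (W.W true true) with hW | hW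
  · rcases le_max_iff.1 hm.1 with h1 | h1
    · exact Or.inl (blockProb_le_of_agreement_le hW hx hx' (by exact_mod_cast h1))
    · exact Or.inr (blockProb_le_of_agreement_le hW hx hcx' (by exact_mod_cast h1))
  · rcases le_max_iff.1 hm.2 with h1 | h1
    · refine Or.inr (blockProb_le_of_disagreement_le hW hx hcx' ?_)
      rw [complement_complement]
      exact_mod_cast h1
    · exact Or.inl (blockProb_le_of_disagreement_le hW hx hx' (by exact_mod_cast h1))

/-- Markov's inequality: each column of the channel sums to twice the uniform output law, so the
likelihoods of all inputs sum to `2 ^ n` times the output probability. -/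
lemma card_le_of_le_blockProb (W : BMC) {n : ℕ} (y : Fin n → Bool) {θ : ℝ} (hθ : 0 < θ)
    (hQ : 0 < ∏ i, unifOut W (y i)) :
    (#{x | θ * ∏ i, unifOut W (y i) ≤ W.blockProb x y} : ℝ) ≤ 2 ^ n / θ := by
  have hsum : ∑ x : Fin n → Bool, W.blockProb x y = 2 ^ n * ∏ i, unifOut W (y i) := by
    unfold DMC.blockProb
    rw [sum_prod_eq_prod_sum (fun k b => W.W b (y k))]
    simp_rw [sum_eq_two_mul_unifOut, Finset.prod_mul_distrib]
    simp
  have h1 : (#{x | θ * ∏ i, unifOut W (y i) ≤ W.blockProb x y} : ℝ) *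
      (θ * ∏ i, unifOut W (y i)) ≤ 2 ^ n * ∏ i, unifOut W (y i) := by
    rw [← hsum, ← nsmul_eq_mul]
    refine (Finset.card_nsmul_le_sum _ (fun x => W.blockProb x y) _ fun x hx => ?_).trans
      (Finset.sum_le_sum_of_subset_of_nonneg (Finset.filter_subset _ _) fun x _ _ =>
        blockProb_nonneg _ _ _)
    exact (Finset.mem_filter.1 hx).2
  rw [le_div_iff₀ hθ]
  refine le_of_mul_le_mul_right ?_ hQ
  linarith

/-- Few balanced words have a score as high as a word of high likelihood. -/
lemma card_score_le (W : BMC) (hx : x ∈ balanced N) {θ : ℝ} (hθ : 0 < θ)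
    (hQ : 0 < ∏ i, unifOut W (y i)) (hxy : θ * ∏ i, unifOut W (y i) ≤ W.blockProb x y) :
    (#{x' ∈ balanced N | score hammingMetrics x y ≤ score hammingMetrics x' y} : ℝ) ≤
      2 * (2 ^ (2 * N) / θ) := by
  classical
  set A : Finset (Fin (2 * N) → Bool) := {x | θ * ∏ i, unifOut W (y i) ≤ W.blockProb x y} with hA
  have hsub : {x' ∈ balanced N | score hammingMetrics x y ≤ score hammingMetrics x' y} ⊆
      A ∪ A.image complement := by
    intro x' hx'
    rw [Finset.mem_filter] at hx'
    rw [Finset.mem_union, Finset.mem_image]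
    rcases blockProb_le_of_score_le W hx hx'.1 hx'.2 with h | h
    · exact Or.inl (by simpa [hA] using hxy.trans h)
    · exact Or.inr ⟨complement x', by simpa [hA] using hxy.trans h, complement_complement x'⟩
  have h1 := (Finset.card_le_card hsub).trans (Finset.card_union_le _ _)
  have h2 : #(A.image complement) ≤ #A := Finset.card_image_le
  have h3 : (#A : ℝ) ≤ 2 ^ (2 * N) / θ := card_le_of_le_blockProb W y hθ hQ
  have h4 : #{x' ∈ balanced N | score hammingMetrics x y ≤ score hammingMetrics x' y} ≤ 2 * #A := by
    omega
  have h5 : (#{x' ∈ balanced N | score hammingMetrics x y ≤ score hammingMetrics x' y} : ℝ) ≤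
    2 * #A := by exact_mod_cast h4
  linarith

lemma card_balanced (N : ℕ) : #(balanced N) = N.centralBinom := by
  rw [Nat.centralBinom_eq_two_mul_choose]
  have := Finset.card_powersetCard N (Finset.univ : Finset (Fin (2 * N)))
  rw [Finset.card_univ, Fintype.card_fin] at this
  rw [← this]
  refine Finset.card_bij' (fun x _ => Finset.univ.filter fun i => x i = true)
    (fun s _ => fun i => decide (i ∈ s))
    ?_ ?_ ?_ ?_
  · intro x hx
    rw [mem_balanced] at hx
    rw [Finset.mem_powersetCard]
    exact ⟨Finset.subset_univ _, by rw [Finset.card_filter]; exact hx⟩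
  · intro s hs
    rw [Finset.mem_powersetCard] at hs
    rw [mem_balanced]
    simp [hs.2]
  · intro x _
    funext i
    simp
  · intro s _
    ext i
    simp

/-- Balanced words are a polynomial fraction of all words, so drawing only from them costs no rate.
-/
lemma two_pow_le_card_balanced (hN : 0 < N) :
    (2 : ℝ) ^ (2 * N) ≤ 2 * N * #(balanced N) := by
  have := Nat.four_pow_le_two_mul_self_mul_centralBinom N hN
  rw [card_balanced, pow_mul]
  norm_num
  exact_mod_cast this

/-- Each balanced word uses the two letters equally often, so its mean information density is the
same for all codewords, whatever the channel. -/
lemma sum_rowDiv_balanced (W : BMC) (hx : x ∈ balanced N) :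
    ∑ i, rowDiv W (unifOut W) (x i) =
      ((2 * N : ℕ) : ℝ) * (mutualInfo uniformInput W * Real.log 2) := by
  rw [mem_balanced] at hx
  have hN : (∑ i, (if x i = true then 1 else 0) : ℝ) = N := by exact_mod_cast hx
  rw [mutualInfo_eq, Fintype.sum_bool]
  have : ∀ i, rowDiv W (unifOut W) (x i) = rowDiv W (unifOut W) false +
      (if x i = true then 1 else 0) * (rowDiv W (unifOut W) true - rowDiv W (unifOut W) false) := by
    intro i
    cases x i <;> simp
  simp_rw [this]
  rw [Finset.sum_add_distrib, ← Finset.sum_mul, hN]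
  simp only [Finset.sum_const, Finset.card_univ, Fintype.card_fin, nsmul_eq_mul, uniformInput]
  push_cast
  unfold unifOut
  ring

/-- The reciprocal of the number of words with the same joint type with `x` as `y`. -/
noncomputable def typeWeight {n : ℕ} (x y : Fin n → Bool) : ℝ :=
  1 / (#{y' | jointType x y' = jointType x y} : ℝ)

lemma typeWeight_nonneg {n : ℕ} (x y : Fin n → Bool) : 0 ≤ typeWeight x y := by
  unfold typeWeight; positivity

/-- The type weight dominates every memoryless channel. -/
lemma blockProb_le_typeWeight (W : BMC) {n : ℕ} (x y : Fin n → Bool) :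
    W.blockProb x y ≤ typeWeight x y := by
  have hpos : 0 < #{y' | jointType x y' = jointType x y} :=
    Finset.card_pos.2 ⟨y, by simp⟩
  unfold typeWeight
  rw [le_div_iff₀ (by exact_mod_cast hpos), mul_comm, ← nsmul_eq_mul, ← Finset.sum_const,
    ← sum_blockProb W x]
  -- The likelihood is constant on the class of outputs with a given joint type, and its total over
  -- the class is at most one.
  refine (Finset.sum_le_sum fun y' hmem => le_of_eq ?_).trans
    (Finset.sum_le_sum_of_subset_of_nonneg (Finset.filter_subset _ _) fun y' _ _ =>
      blockProb_nonneg W x y')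
  rw [blockProb_eq_jointType, blockProb_eq_jointType, (Finset.mem_filter.1 hmem).2]

/-- There are at most `(n + 1) ^ 4` joint types. -/
lemma sum_typeWeight_le {n : ℕ} (x : Fin n → Bool) : ∑ y, typeWeight x y ≤ (n + 1) ^ 4 := by
  classical
  set T : Finset (Bool × Bool → ℕ) := Fintype.piFinset fun _ => Finset.range (n + 1) with hT
  have hmaps : ∀ y ∈ (Finset.univ : Finset (Fin n → Bool)), jointType x y ∈ T := by
    intro y _
    rw [hT, Fintype.mem_piFinset]
    intro p
    rw [Finset.mem_range, Nat.lt_succ_iff]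
    exact (Finset.card_le_univ _).trans (by simp)
  rw [← Finset.sum_fiberwise_of_maps_to hmaps]
  have hcard : (#T : ℝ) = (n + 1) ^ 4 := by
    rw [hT, Fintype.card_piFinset]
    simp
  rw [← hcard, Finset.card_eq_sum_ones, Nat.cast_sum]
  refine Finset.sum_le_sum fun t _ => ?_
  have e : ∑ y with jointType x y = t, typeWeight x y =
      ∑ y with jointType x y = t, 1 / (#{y' | jointType x y' = t} : ℝ) := by
    refine Finset.sum_congr rfl fun y hy => ?_
    unfold typeWeight
    rw [(Finset.mem_filter.1 hy).2]
  rw [e, Finset.sum_const, nsmul_eq_mul, mul_one_div, Nat.cast_one]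
  -- A joint type that does not occur has an empty class and contributes `0 / 0 = 0`.
  exact div_self_le_one _

end JointType

/-! ### Random coding by averaging over all codebooks. -/

section RandomCoding

variable {α : Type*} [Fintype α]

/-- Two distinct codewords of a uniform codebook are independent and uniform; the other `M - 2` are
free. -/
lemma sum_apply_apply {M : ℕ} {m m' : Fin M} (hm : m' ≠ m) (g : α → α → ℝ) :
    ∑ F : Fin M → α, g (F m) (F m') =
      (Fintype.card α : ℝ) ^ (M - 2) * ∑ x, ∑ x', g x x' := by
  classical
  rw [← (Equiv.funSplitAt m α).symm.sum_comp, Fintype.sum_prod_type, Finset.mul_sum]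
  refine Finset.sum_congr rfl fun x _ => ?_
  have h := Fintype.sum_piFinset_apply (ι := {j // j ≠ m}) (fun x' => g x x')
    (Finset.univ : Finset α) ⟨m', hm⟩
  rw [Fintype.piFinset_univ] at h
  have hc : Fintype.card {j // j ≠ m} - 1 = M - 2 := by
    simp [Fintype.card_subtype_compl]
    omega
  rw [hc] at h
  simp only [nsmul_eq_mul, Finset.card_univ, Nat.cast_pow] at h
  rw [← h]
  refine Finset.sum_congr rfl fun H _ => ?_
  simp [Equiv.funSplitAt, Equiv.piSplitAt, hm]

/-- The random coding argument: some codebook has at most average pairwise cost. -/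
lemma exists_codebook [Nonempty α] {M : ℕ} {g : α → α → ℝ} {β : ℝ}
    (hβ : ∀ x, ∑ x', g x x' ≤ β * Fintype.card α) :
    ∃ F : Fin M → α, ∑ m, ∑ m' with m' ≠ m, g (F m) (F m') ≤ M * (M - 1) * β := by
  classical
  have hα : (0 : ℝ) < Fintype.card α := by exact_mod_cast Fintype.card_pos
  by_contra! hcon
  have h1 : ∑ F : Fin M → α, M * (M - 1) * β <
      ∑ F : Fin M → α, ∑ m, ∑ m' with m' ≠ m, g (F m) (F m') :=
    Finset.sum_lt_sum_of_nonempty Finset.univ_nonempty fun F _ => hcon F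
  refine absurd h1 (not_lt.2 ?_)
  rw [Finset.sum_comm]
  have hpair : ∀ m m' : Fin M, m' ≠ m → ∑ F : Fin M → α, g (F m) (F m') ≤
      (Fintype.card α : ℝ) ^ M * β := by
    intro m m' hm
    rw [sum_apply_apply hm]
    have hM : 2 ≤ M := by
      have := m.2
      have := m'.2
      have : m'.1 ≠ m.1 := fun h => hm (Fin.ext h)
      omega
    have h2 : ∑ x, ∑ x', g x x' ≤ Fintype.card α * (β * Fintype.card α) := by
      refine (Finset.sum_le_sum fun x _ => hβ x).trans (le_of_eq ?_)
      simp
    calc _ ≤ (Fintype.card α : ℝ) ^ (M - 2) * (Fintype.card α * (β * Fintype.card α)) :=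
          mul_le_mul_of_nonneg_left h2 (by positivity)
      _ = (Fintype.card α : ℝ) ^ (M - 2 + 2) * β := by ring
      _ = _ := by rw [Nat.sub_add_cancel hM]
  have hrow : ∀ m : Fin M, ∑ F : Fin M → α, ∑ m' with m' ≠ m, g (F m) (F m') ≤
      (M - 1) * ((Fintype.card α : ℝ) ^ M * β) := by
    intro m
    rw [Finset.sum_comm]
    refine (Finset.sum_le_sum fun m' hm' => hpair m m' (Finset.mem_filter.1 hm').2).trans
      (le_of_eq ?_)
    rw [Finset.sum_const, nsmul_eq_mul, Finset.filter_ne', Finset.card_erase_of_mem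
      (Finset.mem_univ m), Finset.card_univ, Fintype.card_fin, Nat.cast_sub
      (by have := m.2; omega), Nat.cast_one]
  refine (Finset.sum_le_sum fun m _ => hrow m).trans (le_of_eq ?_)
  simp
  ring

end RandomCoding

end CompoundChannel

/-! ### The direct part and the conclusion. -/

namespace CompoundChannel

open Finset Filter Topology

open Classical in
/-- A balanced codebook whose generalized linear decoders work on the whole set of channels. -/
lemma exists_balanced_codebook {S : Set BMC} {I Δ : ℝ} (hΔ : 0 < Δ)
    (hS : ∀ W ∈ S, I ≤ mutualInfo uniformInput W * Real.log 2) {N M : ℕ} (hN : 0 < N)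
    (hM : 0 < M) :
    ∃ F : Fin M → Fin (2 * N) → Bool, ∀ G : (Fin (2 * N) → Bool) → Fin M,
      IsGLD hammingMetrics F G → ∀ W ∈ S, errorProb F G W ≤
        8 / ((2 * N : ℕ) * Δ ^ 2) + M * (2 * (2 * N : ℕ) * ((2 * N : ℕ) + 1) ^ 4 /
          Real.exp ((2 * N : ℕ) * (I - Δ))) := by
  set n : ℕ := 2 * N with hn
  have hn0 : 0 < n := by omega
  set θ : ℝ := Real.exp (n * (I - Δ)) with hθ
  have hθ0 : 0 < θ := Real.exp_pos _
  -- The pair need only be typical for some channel of the set, and the cost below uses `typeWeight`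
  -- in place of a likelihood. The cost is thus free of the channel, so one codebook works for an
  -- infinite set.
  set good : (Fin n → Bool) → (Fin n → Bool) → Prop := fun x y =>
    ∃ W ∈ S, 0 < ∏ i, unifOut W (y i) ∧ θ * ∏ i, unifOut W (y i) ≤ W.blockProb x y with hgood
  set g : balanced N → balanced N → ℝ := fun x x' => ∑ y, if good x y then
    typeWeight x.1 y * (if score hammingMetrics x.1 y ≤ score hammingMetrics x'.1 y then 1 else 0)
    else 0 with hg
  have hcard : 0 < #(balanced N) := by
    rw [card_balanced]; exact Nat.centralBinom_pos N
  have : Nonempty (balanced N) := (Finset.card_pos.1 hcard).to_subtype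
  set β : ℝ := 2 * n * (n + 1) ^ 4 / θ with hβ
  have hβ0 : 0 ≤ β := by positivity
  have hrow : ∀ x, ∑ x', g x x' ≤ β * Fintype.card (balanced N) := by
    intro x
    simp only [hg]
    rw [Finset.sum_comm]
    have hy : ∀ y, ∑ x' : balanced N, (if good x y then typeWeight x.1 y *
        (if score hammingMetrics x.1 y ≤ score hammingMetrics x'.1 y then 1 else 0) else 0) ≤
        typeWeight x.1 y * (2 * n * #(balanced N) / θ) := by
      intro y
      have hw := typeWeight_nonneg x.1 y
      by_cases h : good x y
      · simp only [h, if_true]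
        rw [← Finset.mul_sum]
        refine mul_le_mul_of_nonneg_left ?_ hw
        obtain ⟨W, _, hQ, hW⟩ := h
        have hc := card_score_le W x.2 hθ0 hQ hW
        have e : ∑ x' : balanced N,
            (if score hammingMetrics x.1 y ≤ score hammingMetrics x'.1 y then (1 : ℝ) else 0) =
            (#{x' ∈ balanced N | score hammingMetrics x.1 y ≤ score hammingMetrics x' y} : ℝ) := by
          rw [Finset.sum_coe_sort (balanced N) (fun x' =>
            if score hammingMetrics x.1 y ≤ score hammingMetrics x' y then (1 : ℝ) else 0),
            Finset.sum_boole]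
        rw [e]
        refine hc.trans ?_
        rw [← mul_div_assoc]
        refine div_le_div_of_nonneg_right ?_ hθ0.le
        have := two_pow_le_card_balanced hN
        rw [hn]
        push_cast
        linarith
      · simp only [h, if_false, Finset.sum_const_zero]
        positivity
    refine (Finset.sum_le_sum fun y _ => hy y).trans ?_
    rw [← Finset.sum_mul, Fintype.card_coe]
    calc _ ≤ ((n : ℝ) + 1) ^ 4 * (2 * n * #(balanced N) / θ) :=
          mul_le_mul_of_nonneg_right (sum_typeWeight_le x.1) (by positivity)
      _ = β * #(balanced N) := by rw [hβ]; ring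
  obtain ⟨F, hF⟩ := exists_codebook (M := M) hrow
  refine ⟨fun m => (F m).1, fun G hG W hW => ?_⟩
  have hM0 : (0 : ℝ) < M := by exact_mod_cast hM
  have hm : ∀ m, ∑ y, (if G y = m then 0 else W.blockProb (F m).1 y) ≤
      8 / (n * Δ ^ 2) + ∑ m' with m' ≠ m, g (F m) (F m') := by
    intro m
    have hdev := sum_blockProb_lt_le W hn0 (F m).1 (L := n * (I - Δ)) hΔ (by
      rw [sum_rowDiv_balanced W (F m).2, ← hn]
      have := mul_le_mul_of_nonneg_left (hS W hW) (Nat.cast_nonneg (α := ℝ) n)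
      linarith)
    rw [← hθ] at hdev
    -- At an error, either the sent word is atypically unlikely or the decoded message is a
    -- competitor of at least equal score. Ties count as errors, so their resolution is irrelevant.
    have hpt : ∀ y, (if G y = m then 0 else W.blockProb (F m).1 y) ≤
        (if W.blockProb (F m).1 y < θ * ∏ i, unifOut W (y i) then W.blockProb (F m).1 y else 0) +
        ∑ m' with m' ≠ m, (if good (F m) y then typeWeight (F m).1 y *
          (if score hammingMetrics (F m).1 y ≤ score hammingMetrics (F m').1 y then 1 else 0)
            else 0) := by
      intro y
      have hnn := blockProb_nonneg W (F m).1 y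
      have hterm : ∀ m', 0 ≤ (if good (F m) y then typeWeight (F m).1 y *
          (if score hammingMetrics (F m).1 y ≤ score hammingMetrics (F m').1 y then (1 : ℝ) else 0)
            else 0) := by
        intro m'
        have hw := typeWeight_nonneg (F m).1 y
        split_ifs <;> simp [hw]
      have hsn := Finset.sum_nonneg fun m' (_ : m' ∈ Finset.univ.filter (· ≠ m)) => hterm m'
      by_cases hGy : G y = m
      · rw [if_pos hGy]
        refine add_nonneg ?_ hsn
        split_ifs
        · exact hnn
        · exact le_rfl
      rw [if_neg hGy]
      by_cases hlt : W.blockProb (F m).1 y < θ * ∏ i, unifOut W (y i)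
      · rw [if_pos hlt]
        linarith
      rw [if_neg hlt, zero_add]
      rcases hnn.eq_or_lt with h0 | h0
      · rwa [← h0]
      have hQ : 0 < ∏ i, unifOut W (y i) := by
        refine Finset.prod_pos fun i _ => (unifOut_nonneg W _).lt_of_ne fun h => h0.ne' ?_
        exact Finset.prod_eq_zero (Finset.mem_univ i) (eq_zero_of_unifOut_eq_zero h.symm _)
      have hgd : good (F m) y := ⟨W, hW, hQ, not_lt.1 hlt⟩
      refine le_trans ?_ (Finset.single_le_sum (fun m' _ => hterm m')
        (Finset.mem_filter.2 ⟨Finset.mem_univ (G y), hGy⟩))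
      rw [if_pos hgd, if_pos (hG y m), mul_one]
      exact blockProb_le_typeWeight W _ y
    refine (Finset.sum_le_sum fun y _ => hpt y).trans ?_
    rw [Finset.sum_add_distrib, ← Finset.sum_filter]
    refine add_le_add hdev (le_of_eq ?_)
    rw [Finset.sum_comm]
  unfold errorProb
  have htot : ∑ m, ∑ y, (if G y = m then 0 else W.blockProb (F m).1 y) ≤
      M * (8 / (n * Δ ^ 2) + M * β) := by
    refine (Finset.sum_le_sum fun m _ => hm m).trans ?_
    rw [Finset.sum_add_distrib]
    simp only [Finset.sum_const, Finset.card_univ, Fintype.card_fin, nsmul_eq_mul]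
    have : (M : ℝ) * (M - 1) * β ≤ M * (M * β) := by
      have : 0 ≤ M * β := by positivity
      linarith
    linarith
  calc _ ≤ 1 / (M : ℝ) * (M * (8 / (n * Δ ^ 2) + M * β)) :=
        mul_le_mul_of_nonneg_left htot (by positivity)
    _ = _ := by field_simp

/-- The direct part: every rate below the worst-case information of the uniform input law. -/
theorem achievableByGLD_of_lt {S : Set BMC} {R R' : ℝ} (hR : 0 ≤ R) (hRR : R < R')
    (hS : ∀ W ∈ S, R' ≤ mutualInfo uniformInput W) : AchievableByGLD hammingMetrics S R := by
  intro ε hε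
  have hl2 := Real.log_pos one_lt_two
  -- Half of the rate gap, in nats, pays for Chebyshev's bound; the other half leaves `e^(-Δ n)` to
  -- beat the polynomial factors.
  set Δ : ℝ := (R' - R) / 2 * Real.log 2 with hΔ
  have hΔ0 : 0 < Δ := mul_pos (by linarith) hl2
  have ht1 : Tendsto (fun n : ℕ => 8 / (n * Δ ^ 2)) atTop (𝓝 0) :=
    Tendsto.div_atTop tendsto_const_nhds
      (tendsto_natCast_atTop_atTop.atTop_mul_const (by positivity))
  have ht2 : Tendsto (fun n : ℕ => 64 * ((n : ℝ) ^ 5 * Real.exp (-Δ * n))) atTop (𝓝 0) := by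
    have := (Real.summable_pow_mul_exp_neg_nat_mul 5 hΔ0).tendsto_atTop_zero.const_mul 64
    simpa using this
  have ht := ht1.add ht2
  rw [add_zero] at ht
  have hdouble : Tendsto (fun N : ℕ => 2 * N) atTop atTop :=
    tendsto_id.const_mul_atTop' two_pos
  obtain ⟨N, hNε, hN⟩ :=
    (((ht.comp hdouble).eventually_lt_const hε).and (eventually_gt_atTop 0)).exists
  simp only [Function.comp] at hNε
  set n : ℕ := 2 * N with hn
  have hn1 : (1 : ℝ) ≤ n := by exact_mod_cast (show 1 ≤ n by omega)
  set M : ℕ := ⌈(2 : ℝ) ^ ((n : ℝ) * R)⌉₊ with hM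
  have hpow1 : (1 : ℝ) ≤ (2 : ℝ) ^ ((n : ℝ) * R) :=
    Real.one_le_rpow one_le_two (by positivity)
  have hM0 : 0 < M := Nat.ceil_pos.2 (by positivity)
  have hM2 : (M : ℝ) ≤ 2 * (2 : ℝ) ^ ((n : ℝ) * R) := by
    have := Nat.ceil_lt_add_one (a := (2 : ℝ) ^ ((n : ℝ) * R)) (by positivity)
    linarith
  obtain ⟨F, hF⟩ := exists_balanced_codebook (S := S) (I := R' * Real.log 2) hΔ0
    (fun W hW => mul_le_mul_of_nonneg_right (hS W hW) hl2.le) hN hM0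
  refine ⟨n, M, by omega, Nat.le_ceil _, F, fun G hG W hW => (hF G hG W hW).trans_lt ?_⟩
  refine lt_of_le_of_lt (add_le_add le_rfl ?_) hNε
  have hexp : Real.exp (n * (R' * Real.log 2 - Δ)) =
      (2 : ℝ) ^ ((n : ℝ) * R) * Real.exp (Δ * n) := by
    rw [Real.rpow_def_of_pos two_pos, ← Real.exp_add, hΔ]
    congr 1
    ring
  have hpoly : 2 * (n : ℝ) * (n + 1) ^ 4 ≤ 32 * n ^ 5 := by
    have : ((n : ℝ) + 1) ^ 4 ≤ (2 * n) ^ 4 := pow_le_pow_left₀ (by positivity) (by linarith) 4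
    calc 2 * (n : ℝ) * (n + 1) ^ 4 ≤ 2 * n * (2 * n) ^ 4 :=
          mul_le_mul_of_nonneg_left this (by positivity)
      _ = 32 * n ^ 5 := by ring
  calc (M : ℝ) * (2 * n * (n + 1) ^ 4 / Real.exp (n * (R' * Real.log 2 - Δ)))
      ≤ 2 * (2 : ℝ) ^ ((n : ℝ) * R) * (32 * n ^ 5 / Real.exp (n * (R' * Real.log 2 - Δ))) :=
        mul_le_mul hM2 (div_le_div_of_nonneg_right hpoly (Real.exp_pos _).le) (by positivity)
          (by positivity)
    _ = 64 * (n ^ 5 * Real.exp (-Δ * n)) := by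
        rw [hexp, neg_mul, Real.exp_neg]
        field_simp
        norm_num

/-- A single message is never decoded wrongly. This covers zero capacity, where the direct part may
have no strict gap to use. -/
lemma achievableByGLD_zero {X Y : Type} [Fintype Y] [Nonempty X] {K : ℕ} (d : Fin K → X → Y → ℝ)
    (S : Set (DMC X Y)) : AchievableByGLD d S 0 := by
  intro ε hε
  refine ⟨1, 1, one_pos, by simp, fun _ _ => Classical.arbitrary X, fun G _ W _ => ?_⟩
  have h0 : ∀ y, G y = 0 := fun y => Subsingleton.elim _ _
  simpa [errorProb, h0] using hε

lemma AchievableByGLD.achievable {X Y : Type} [Fintype Y] {K : ℕ} {d : Fin K → X → Y → ℝ}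
    {S : Set (DMC X Y)} {R : ℝ} (h : AchievableByGLD d S R) : Achievable S R := by
  intro ε hε
  obtain ⟨n, M, hn, hM, F, hF⟩ := h ε hε
  have hM0 : (0 : ℝ) < M := lt_of_lt_of_le (by positivity) hM
  have : Nonempty (Fin M) := ⟨⟨0, by exact_mod_cast hM0⟩⟩
  choose G hG using fun y : Fin n → Y => Finite.exists_max fun m => score d (F m) y
  exact ⟨n, M, hn, hM, F, G, hF G fun y m => hG y m⟩

lemma bddBelow_mutualInfo {P : Bool → ℝ} (hP : P ∈ stdSimplex ℝ Bool) (S : Set BMC) :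
    BddBelow (Set.range fun W : S => mutualInfo P W.1) :=
  ⟨0, by rintro _ ⟨W, rfl⟩; exact mutualInfo_nonneg hP W.1⟩

lemma worstInfo_le {P : Bool → ℝ} (hP : P ∈ stdSimplex ℝ Bool) {S : Set BMC} {W : BMC}
    (hW : W ∈ S) : worstInfo S P ≤ mutualInfo P W :=
  ciInf_le (bddBelow_mutualInfo hP S) (⟨W, hW⟩ : S)

/-- An achievable rate is nearly the worst-case information of some input law. -/
lemma Achievable.exists_le_worstInfo {S : Set BMC} (hS : S.Nonempty) {R : ℝ}
    (hR : Achievable S R) {η : ℝ} (hη : 0 < η) :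
    ∃ P ∈ stdSimplex ℝ Bool, R ≤ worstInfo S P + η := by
  obtain ⟨P, hP, h⟩ := hR.exists_le_mutualInfo hη
  have : Nonempty S := hS.to_subtype
  refine ⟨P, hP, ?_⟩
  have : R - η ≤ worstInfo S P := le_ciInf fun W => by linarith [h W.1 W.2]
  linarith

lemma worstInfo_le_uniformInput {S : Set BMC} (hS : S.Nonempty) {P : Bool → ℝ}
    (hP : P ∈ stdSimplex ℝ Bool) :
    (94205 / 100000) * worstInfo S P ≤ worstInfo S uniformInput := by
  have : Nonempty S := hS.to_subtype
  refine le_ciInf fun W => ?_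
  have h1 := worstInfo_le hP W.2
  have h2 := mutualInfo_le_uniformInput hP W.1
  linarith

lemma Achievable.le_uniformInput {S : Set BMC} (hS : S.Nonempty) {R : ℝ} (hR : Achievable S R) :
    (94205 / 100000) * R ≤ worstInfo S uniformInput := by
  refine le_of_forall_pos_le_add fun η hη => ?_
  obtain ⟨P, hP, h⟩ := hR.exists_le_worstInfo hS hη
  have := worstInfo_le_uniformInput hS hP
  linarith

/-- Ensures that the supremum defining the capacity is genuine and not the default value `0`. -/
lemma bddAbove_achievable {S : Set BMC} (hS : S.Nonempty) : BddAbove {R | Achievable S R} :=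
  ⟨worstInfo S uniformInput / (94205 / 100000), fun R hR => by
    rw [le_div_iff₀ (by norm_num), mul_comm]
    exact Achievable.le_uniformInput hS hR⟩

lemma achievable_zero (S : Set BMC) : Achievable S 0 :=
  (achievableByGLD_zero hammingMetrics S).achievable

lemma compoundCapacity_nonneg {S : Set BMC} (hS : S.Nonempty) : 0 ≤ compoundCapacity S :=
  le_csSup (bddAbove_achievable hS) (achievable_zero S)

lemma compoundCapacity_le_uniformInput {S : Set BMC} (hS : S.Nonempty) :
    (94205 / 100000) * compoundCapacity S ≤ worstInfo S uniformInput := by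
  have : compoundCapacity S ≤ worstInfo S uniformInput / (94205 / 100000) := by
    refine csSup_le ⟨0, achievable_zero S⟩ fun R hR => ?_
    rw [le_div_iff₀ (by norm_num), mul_comm]
    exact Achievable.le_uniformInput hS hR
  rw [le_div_iff₀ (by norm_num)] at this
  linarith

lemma compoundCapacity_le_of_isOptimalInput {S : Set BMC} (hS : S.Nonempty) {P : Bool → ℝ}
    (hP : IsOptimalInput S P) : compoundCapacity S ≤ worstInfo S P := by
  refine csSup_le ⟨0, achievable_zero S⟩ fun R hR => le_of_forall_pos_le_add fun η hη => ?_
  obtain ⟨P', hP', h⟩ := Achievable.exists_le_worstInfo hS hR hη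
  have : worstInfo S P' ≤ worstInfo S P := hP.2 hP'
  linarith

end CompoundChannel

theorem corollary2 :
    ∃ d : Fin 2 → Bool → Bool → ℝ,
      ∀ S : Set CompoundChannel.BMC, S.Nonempty →
        CompoundChannel.AchievableByGLD d S
          ((942 / 1000 : ℝ) * CompoundChannel.compoundCapacity S) ∧
        (CompoundChannel.IsOptimalInput S CompoundChannel.uniformInput →
          IsLUB {R : ℝ | CompoundChannel.AchievableByGLD d S R}
            (CompoundChannel.compoundCapacity S)) := by
  open CompoundChannel in
  refine ⟨hammingMetrics, fun S hS => ⟨?_, fun hopt => ⟨fun R hR => ?_, fun b hb => ?_⟩⟩⟩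
  · have h := compoundCapacity_le_uniformInput hS
    rcases (compoundCapacity_nonneg hS).eq_or_lt with h0 | h0
    · rw [← h0, mul_zero]
      exact achievableByGLD_zero _ _
    · exact achievableByGLD_of_lt (R' := worstInfo S uniformInput) (by positivity) (by linarith)
        fun W hW => worstInfo_le uniformInput_mem hW
  · exact le_csSup (bddAbove_achievable hS) hR.achievable
  · refine (compoundCapacity_le_of_isOptimalInput hS hopt).trans ?_
    have hb0 : 0 ≤ b := hb (achievableByGLD_zero hammingMetrics S)
    by_contra! hlt
    -- A rate midway between `b` and the worst-case information would be achievable and exceed the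
    -- upper bound `b`.
    have hmid := hb (achievableByGLD_of_lt (R := (b + worstInfo S uniformInput) / 2)
      (by linarith) (by linarith) fun W hW => worstInfo_le uniformInput_mem hW)
    linarith
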